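/- Let $\Xi$ be a Hausdorff, locally compact, $\sigma$-compact topological groupoid with unit space $X$, source and range maps ${\rm d},{\rm r}:\Xi\to X$ and fibres $\Xi_x={\rm d}^{-1}(x)$, let $\{\lambda_x\}_{x\in X}$ be a right Haar system on $\Xi$ (regular Borel measures $\lambda_x$ of full support on $\Xi_x$, such that $x\mapsto\int_{\Xi_x} f\,d\lambda_x$ is continuous for every $f\in C_{\rm c}(\Xi)$ and such that, for every $\xi\in\Xi$, right multiplication by $\xi$ transports $\lambda_{{\rm r}(\xi)}$ to $\lambda_{{\rm d}(\xi)}$), and let $\omega$ be a normalized continuous $2$-cocycle on $\Xi$ with values in the unit circle $\mathbb T$. For $x\in X$ let $\Pi_x$ be the regular representation of $C_{\rm c}(\Xi)$ on $\mathcal H_x=L^2(\Xi_x;\lambda_x)$, $$(\Pi_x(f)u)(\xi)=\int_{\Xi_x} f(\xi\eta^{-1})\,u(\eta)\,\omega(\xi\eta^{-1},\eta)\,d\lambda_x(\eta),$$ and let $\mathscr C={\sf C}^*_{\rm r}(\Xi,\omega)$ be the reduced twisted groupoid $C^*$-algebra, i.e. the completion of $C_{\rm c}(\Xi)$ (with twisted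 convolution and involution) in the norm $\sup_{x\in X}\|\Pi_x(f)\|$. Let $F$ be an element of the multiplier algebra $\mathscr C^{\bf M}$, and put $H_x=\Pi_x^{\bf M}(F)\in\mathbb B(\mathcal H_x)$, where $\Pi_x^{\bf M}$ is the canonical extension of $\Pi_x$ to $\mathscr C^{\bf M}$. Let $\Sigma$ be a $C^*$-algebraic spectral set: to every element $E$ of every unital complex $C^*$-algebra $\mathscr E$ it assigns a closed set $\Sigma(E\,|\,\mathscr E)\subset\mathbb C$, in such a way that $\Sigma(\pi(E)\,|\,\mathscr F)\subset\Sigma(E\,|\,\mathscr E)$ for every unital $*$-morphism $\pi:\mathscr E\to\mathscr F$, with equality if $\pi$ is injective. Write $\Sigma(H_x)=\Sigma(H_x\,|\,\mathbb B(\mathcal H_x))$. The orbit of $x\in X$ is $\mathcal O_x={\rm r}(\Xi_x)$, and an orbit closure is a set of the form $\overline{\mathcal O_z}$ with $z\in X$. Let $\mathcal Q\subset X$ be an orbit closure. A point $x\in\mathcal Q$ is generic if $\overline{\mathcal O_x}=\mathcal Q$; and $\mathcal Q$ is $\Xi$-minimal if $\emptyset$ and $\mathcal Q$ are the only closed subsets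 $A\subset\mathcal Q$ that are invariant (that is, $\mathcal O_x\subset A$ for all $x\in A$). Then $\Sigma(H_x)=\Sigma(H_y)$ for all generic points $x,y$ of $\mathcal Q$. In particular, if $\mathcal Q$ is $\Xi$-minimal, then $\Sigma(H_x)=\Sigma(H_y)$ for all $x,y\in\mathcal Q$. -/

import Mathlib

open MeasureTheory Filter Topology
open scoped ENNReal CompactlySupported InnerProductSpace MultiplierAlgebra

universe u

/-- A `C*`-algebraic spectral set (over the unital complex `C*`-algebras in the universe `u`): a
closed subset of `ℂ` for every element of every such algebra, which shrinks under unital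
`*`-morphisms and is preserved by the injective ones. -/
structure CStarSpectralSet where
  toFun : ∀ (E : Type u) [CStarAlgebra E], E → Set ℂ
  isClosed : ∀ (E : Type u) [CStarAlgebra E] (a : E), IsClosed (toFun E a)
  map_subset : ∀ (E F : Type u) [CStarAlgebra E] [CStarAlgebra F] (π : E →⋆ₐ[ℂ] F) (a : E),
    toFun F (π a) ⊆ toFun E a
  map_eq_of_injective : ∀ (E F : Type u) [CStarAlgebra E] [CStarAlgebra F] (π : E →⋆ₐ[ℂ] F),
    Function.Injective π → ∀ a : E, toFun F (π a) = toFun E a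

namespace MultiplierExtension

section Extension

variable {A : Type*} [NonUnitalCStarAlgebra A]
variable {H : Type*} [NormedAddCommGroup H] [InnerProductSpace ℂ H] [CompleteSpace H]
variable (π : A →⋆ₙₐ[ℂ] (H →L[ℂ] H)) (F : 𝓜(ℂ, A))

theorem fst_mul (F : 𝓜(ℂ, A)) (a b : A) : F.fst (a * b) = F.fst a * b := by
  have h : ∀ z, z * (F.fst (a * b) - F.fst a * b) = 0 := fun z => by
    rw [mul_sub, ← mul_assoc, ← F.central, ← F.central, mul_assoc, sub_self]
  exact sub_eq_zero.1 (CStarRing.star_mul_self_eq_zero_iff _ |>.1 (h (star _)))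

theorem eq_top_of_mem (W : Submodule ℂ H) (hW : IsClosed (W : Set H))
    (h1 : ∀ a v, π a v ∈ W) (h2 : ∀ v, (∀ a, π a v = 0) → v ∈ W) : W = ⊤ := by
  have : CompleteSpace W := hW.completeSpace_coe
  rw [← Submodule.orthogonal_eq_bot_iff, Submodule.eq_bot_iff]
  intro q hq
  have hq0 : q ∈ W := h2 q fun a => by
    rw [← inner_self_eq_zero (𝕜 := ℂ)]
    have e : (inner ℂ (π a q) (π a q) : ℂ) = inner ℂ (π (star a) (π a q)) q := by
      rw [map_star, ContinuousLinearMap.star_eq_adjoint, ContinuousLinearMap.adjoint_inner_left]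
    rw [e]
    exact hq _ (h1 _ _)
  exact inner_self_eq_zero.1 (hq q hq0)

theorem exists_tendsto [PartialOrder A] [StarOrderedRing A] (v : H) :
    ∃ w, Tendsto (fun e => π (F.fst e) v) (CStarAlgebra.approximateUnit A) (𝓝 w) := by
  set l := CStarAlgebra.approximateUnit A with hl
  have hau := CStarAlgebra.increasingApproximateUnit A
  have hbd : ∀ᶠ e in l, ∀ v, ‖π (F.fst e) v‖ ≤ ‖F.fst‖ * ‖v‖ := by
    filter_upwards [hau.eventually_norm] with e he v
    refine (ContinuousLinearMap.le_opNorm _ _).trans ?_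
    gcongr
    exact (NonUnitalStarAlgHom.norm_apply_le π _).trans
      ((F.fst.le_opNorm e).trans (mul_le_of_le_one_right (norm_nonneg _) he))
  let W : Submodule ℂ H :=
    { carrier := {v | ∃ w, Tendsto (fun e => π (F.fst e) v) l (𝓝 w)}
      add_mem' := by
        rintro v v' ⟨w, hw⟩ ⟨w', hw'⟩
        exact ⟨w + w', by simpa only [map_add] using hw.add hw'⟩
      zero_mem' := ⟨0, by simp⟩
      smul_mem' := by
        rintro c v ⟨w, hw⟩
        exact ⟨c • w, by simpa only [map_smul] using hw.const_smul c⟩ }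
  have hW : IsClosed (W : Set H) := by
    rw [← closure_subset_iff_isClosed]
    intro v hv
    refine (cauchy_map_iff_exists_tendsto (l := l)).1 ?_
    rw [Metric.cauchy_iff]
    refine ⟨inferInstance, fun ε hε => ?_⟩
    have hC : 0 < ‖F.fst‖ + 1 := by positivity
    obtain ⟨v', ⟨w, hw⟩, hv'⟩ := Metric.mem_closure_iff.1 hv (ε / 4 / (‖F.fst‖ + 1)) (by positivity)
    have hev : ∀ᶠ e in l, dist (π (F.fst e) v) w < ε / 2 := by
      filter_upwards [hbd, Metric.tendsto_nhds.1 hw (ε / 4) (by positivity)] with e he he'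
      have h1 : dist (π (F.fst e) v) (π (F.fst e) v') ≤ ε / 4 := by
        rw [dist_eq_norm, ← map_sub]
        refine (he _).trans ?_
        rw [← dist_eq_norm]
        calc ‖F.fst‖ * dist v v' ≤ (‖F.fst‖ + 1) * (ε / 4 / (‖F.fst‖ + 1)) := by
              gcongr
              linarith
          _ = ε / 4 := by field_simp
      have := dist_triangle (π (F.fst e) v) (π (F.fst e) v') w
      linarith
    refine ⟨_, Filter.image_mem_map hev, ?_⟩
    rintro _ ⟨e, he, rfl⟩ _ ⟨e', he', rfl⟩
    have := dist_triangle_right (π (F.fst e) v) (π (F.fst e') v) w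
    simp only [Set.mem_ofPred_eq] at he he'
    linarith
  have htop : W = ⊤ := by
    refine eq_top_of_mem π W hW (fun a v => ?_) (fun v hv => ⟨0, ?_⟩)
    · refine ⟨π (F.fst a) v, ?_⟩
      have h1 : Tendsto (fun e => e * a) l (𝓝 a) := hau.tendsto_mul_right a
      have h2 : Continuous fun b => π (F.fst b) v :=
        ((ContinuousLinearMap.apply ℂ H v).continuous.comp (map_continuous π)).comp
          F.fst.continuous
      refine ((h2.tendsto a).comp h1).congr fun e => ?_
      simp [fst_mul]
    · simp [hv]
  exact (htop ▸ Submodule.mem_top : v ∈ W)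

/-- A `*`-representation `π` of a `C*`-algebra extends to its multiplier algebra: for every
multiplier `F` there is a unique operator `T` with `T π(a) = π(F a)` for all `a` and vanishing on
the vectors annihilated by `π`. -/
theorem existsUnique_extension :
    ∃! T : H →L[ℂ] H, (∀ a, T ∘L π a = π (F.fst a)) ∧ ∀ v, (∀ a, π a v = 0) → T v = 0 := by
  let _ := CStarAlgebra.spectralOrder A
  let _ := CStarAlgebra.spectralOrderedRing A
  have hau := CStarAlgebra.increasingApproximateUnit A
  choose f hf using exists_tendsto π F
  have hlim : Tendsto (fun e v => (π (F.fst e) : H →ₗ[ℂ] H) v) (CStarAlgebra.approximateUnit A)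
      (𝓝 f) := tendsto_pi_nhds.2 hf
  let T : H →L[ℂ] H := (linearMapOfTendsto f _ hlim).mkContinuous ‖F.fst‖ fun v => by
    refine le_of_tendsto (hf v).norm ?_
    filter_upwards [hau.eventually_norm] with e he
    refine (ContinuousLinearMap.le_opNorm _ _).trans ?_
    gcongr
    exact (NonUnitalStarAlgHom.norm_apply_le π _).trans
      ((F.fst.le_opNorm e).trans (mul_le_of_le_one_right (norm_nonneg _) he))
  have hT : ∀ v, Tendsto (fun e => π (F.fst e) v) (CStarAlgebra.approximateUnit A) (𝓝 (T v)) := hf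
  refine ⟨T, ⟨fun a => ?_, fun v hv => ?_⟩, ?_⟩
  · ext v
    refine tendsto_nhds_unique (hT (π a v)) ?_
    have h2 : Continuous fun b => π (F.fst b) v :=
      ((ContinuousLinearMap.apply ℂ H v).continuous.comp (map_continuous π)).comp
        F.fst.continuous
    refine ((h2.tendsto a).comp (hau.tendsto_mul_right a)).congr fun e => ?_
    simp [fst_mul]
  · refine tendsto_nhds_unique (hT v) ?_
    simp [hv]
  · rintro S ⟨hS1, hS2⟩
    have hT1 : ∀ a, T ∘L π a = π (F.fst a) := fun a => by
      ext v
      refine tendsto_nhds_unique (hT (π a v)) ?_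
      have h2 : Continuous fun b => π (F.fst b) v :=
        ((ContinuousLinearMap.apply ℂ H v).continuous.comp (map_continuous π)).comp
          F.fst.continuous
      refine ((h2.tendsto a).comp (hau.tendsto_mul_right a)).congr fun e => ?_
      simp [fst_mul]
    have hT2 : ∀ v, (∀ a, π a v = 0) → T v = 0 := fun v hv => by
      refine tendsto_nhds_unique (hT v) ?_
      simp [hv]
    have htop : (S - T).ker = ⊤ := by
      refine eq_top_of_mem π _ (S - T).isClosed_ker (fun a v => ?_) (fun v hv => ?_)
      · have h1 := DFunLike.congr_fun (hS1 a) v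
        have h2 := DFunLike.congr_fun (hT1 a) v
        simp only [ContinuousLinearMap.comp_apply] at h1 h2
        simp [h1, h2]
      · simp [hS2 v hv, hT2 v hv]
    ext v
    have : v ∈ (S - T).ker := htop ▸ Submodule.mem_top
    simpa [sub_eq_zero] using this

/-- The extension of a `*`-representation to the multiplier algebra: the unique operator `T` with
`T π(a) = π(F a)` for all `a` and vanishing on the vectors annihilated by `π`. (For a
nondegenerate `π` only the vector `0` is annihilated by `π`.) -/
noncomputable def extension : H →L[ℂ] H := (existsUnique_extension π F).choose

end Extension

section Families

variable {I : Type*} {A : I → Type*} [∀ i, NonUnitalCStarAlgebra (A i)]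

/-- The `C*`-algebra generated by a set of bounded families. -/
noncomputable def generated (s : Set (lp A ∞)) : NonUnitalStarSubalgebra ℂ (lp A ∞) :=
  (NonUnitalStarAlgebra.adjoin ℂ s).topologicalClosure

instance (s : Set (lp A ∞)) : IsClosed (generated s : Set (lp A ∞)) :=
  NonUnitalStarSubalgebra.isClosed_topologicalClosure _

/-- The evaluation at an index, on the `C*`-algebra generated by a set of bounded families. -/
noncomputable def eval (s : Set (lp A ∞)) (i : I) : generated s →⋆ₙₐ[ℂ] A i where
  toFun a := (a : lp A ∞) i
  map_smul' _ _ := rfl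
  map_zero' := rfl
  map_add' _ _ := rfl
  map_mul' _ _ := rfl
  map_star' _ := rfl

end Families

end MultiplierExtension

/-- A topological groupoid with space of arrows `Ξ` and space of units `X`. The units are embedded
in `Ξ` by the continuous section `unit` of `d` and `r`, so `X` carries the topology induced by `Ξ`.
The product is only defined on the set of composable pairs. -/
structure TopologicalGroupoid (Ξ X : Type u) [TopologicalSpace Ξ] [TopologicalSpace X] where
  /-- the source (domain) map -/
  d : Ξ → X
  /-- the range map -/
  r : Ξ → X
  /-- the inclusion of the units -/
  unit : X → Ξ
  inv : Ξ → Ξ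
  /-- the product, on composable pairs -/
  mul : {p : Ξ × Ξ // d p.1 = r p.2} → Ξ
  continuous_d : Continuous d
  continuous_r : Continuous r
  continuous_unit : Continuous unit
  continuous_inv : Continuous inv
  continuous_mul : Continuous mul
  d_unit : ∀ x, d (unit x) = x
  r_unit : ∀ x, r (unit x) = x
  d_inv : ∀ ξ, d (inv ξ) = r ξ
  r_inv : ∀ ξ, r (inv ξ) = d ξ
  d_mul : ∀ ξ η (h : d ξ = r η), d (mul ⟨(ξ, η), h⟩) = d η
  r_mul : ∀ ξ η (h : d ξ = r η), r (mul ⟨(ξ, η), h⟩) = r ξ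
  mul_assoc : ∀ ξ η ζ (h : d ξ = r η) (k : d η = r ζ),
    mul ⟨(mul ⟨(ξ, η), h⟩, ζ), (d_mul ξ η h).trans k⟩ =
      mul ⟨(ξ, mul ⟨(η, ζ), k⟩), h.trans (r_mul η ζ k).symm⟩
  unit_mul : ∀ ξ, mul ⟨(unit (r ξ), ξ), d_unit (r ξ)⟩ = ξ
  mul_unit : ∀ ξ, mul ⟨(ξ, unit (d ξ)), (r_unit (d ξ)).symm⟩ = ξ
  inv_mul : ∀ ξ, mul ⟨(inv ξ, ξ), d_inv ξ⟩ = unit (d ξ)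
  mul_inv : ∀ ξ, mul ⟨(ξ, inv ξ), (r_inv ξ).symm⟩ = unit (r ξ)

namespace TopologicalGroupoid

variable {Ξ X : Type u} [TopologicalSpace Ξ] [TopologicalSpace X] (G : TopologicalGroupoid Ξ X)

/-- The set of composable pairs. -/
abbrev Composable : Type u := {p : Ξ × Ξ // G.d p.1 = G.r p.2}

/-- The fibre of the source map over a unit. -/
abbrev Fiber (x : X) : Type u := {ξ : Ξ // G.d ξ = x}

/-- Right multiplication by `ξ`, from the fibre over `r ξ` to the fibre over `d ξ`. -/
def rightMul (ξ : Ξ) (η : G.Fiber (G.r ξ)) : G.Fiber (G.d ξ) :=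
  ⟨G.mul ⟨(η.1, ξ), η.2⟩, G.d_mul _ _ _⟩

/-- For `ξ, η` in the same fibre of the source map, the composable pair `(ξ η⁻¹, η)`. -/
def divPair {x : X} (ξ η : G.Fiber x) : G.Composable :=
  ⟨(G.mul ⟨(ξ.1, G.inv η.1), ξ.2.trans (η.2.symm.trans (G.r_inv η.1).symm)⟩, η.1),
    (G.d_mul _ _ _).trans (G.d_inv η.1)⟩

/-- The quotient `ξ η⁻¹` of two elements of the same fibre of the source map. -/
def div {x : X} (ξ η : G.Fiber x) : Ξ := (G.divPair ξ η).1.1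

/-- The orbit of a unit: the ranges of all arrows starting at it. -/
def orbit (x : X) : Set X := {y | ∃ ξ, G.d ξ = x ∧ G.r ξ = y}

/-- The orbit closure generated by a unit. -/
def orbitClosure (x : X) : Set X := closure (G.orbit x)

/-- A set of units is an orbit closure if it is the closure of some orbit. -/
def IsOrbitClosure (Q : Set X) : Prop := ∃ x, Q = G.orbitClosure x

/-- A set of units is invariant if it contains the orbit of each of its points. -/
def IsInvariant (A : Set X) : Prop := ∀ x ∈ A, G.orbit x ⊆ A

/-- The generic points of a set `Q` of units: those that generate it as an orbit closure. -/
def genericPoints (Q : Set X) : Set X := {x | x ∈ Q ∧ G.orbitClosure x = Q}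

/-- A set `Q` of units is minimal if its only closed invariant subsets are `∅` and `Q`. -/
def IsMinimal (Q : Set X) : Prop :=
  ∀ A ⊆ Q, IsClosed A → G.IsInvariant A → A = ∅ ∨ A = Q

/-- A right Haar system: a family of regular Borel measures on the fibres of the source map,
of full support, continuous over the units, and invariant under right multiplications. -/
structure HaarSystem [MeasurableSpace Ξ] where
  measure : ∀ x, Measure (G.Fiber x)
  regular : ∀ x, (measure x).Regular
  isOpenPosMeasure : ∀ x, (measure x).IsOpenPosMeasure
  continuous_integral : ∀ f : C_c(Ξ, ℂ), Continuous fun x => ∫ η : G.Fiber x, f η.1 ∂(measure x)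
  map_rightMul : ∀ ξ, (measure (G.r ξ)).map (G.rightMul ξ) = measure (G.d ξ)

/-- A normalized continuous `2`-cocycle with values in the circle. -/
structure TwoCocycle where
  toFun : G.Composable → Circle
  continuous_toFun : Continuous toFun
  cocycle : ∀ ξ η ζ (h : G.d ξ = G.r η) (k : G.d η = G.r ζ),
    toFun ⟨(ξ, η), h⟩ * toFun ⟨(G.mul ⟨(ξ, η), h⟩, ζ), (G.d_mul ξ η h).trans k⟩ =
      toFun ⟨(η, ζ), k⟩ * toFun ⟨(ξ, G.mul ⟨(η, ζ), k⟩), h.trans (G.r_mul η ζ k).symm⟩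
  unit_left : ∀ η, toFun ⟨(G.unit (G.r η), η), G.d_unit (G.r η)⟩ = 1
  unit_right : ∀ ξ, toFun ⟨(ξ, G.unit (G.d ξ)), (G.r_unit (G.d ξ)).symm⟩ = 1

section Algebra

theorem mul_inv_mul_cancel (ξ η : Ξ) (h : G.d ξ = G.r η) :
    G.mul ⟨(G.mul ⟨(ξ, η), h⟩, G.inv η), (G.d_mul ξ η h).trans (G.r_inv η).symm⟩ = ξ := by
  rw [G.mul_assoc ξ η (G.inv η) h (G.r_inv η).symm]
  have e := G.mul_unit ξ
  conv_rhs => rw [← e]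
  congr 3
  rw [G.mul_inv, h]

theorem mul_mul_inv_cancel (ξ η : Ξ) (h : G.d ξ = G.d η) :
    G.mul ⟨(G.mul ⟨(ξ, G.inv η), h.trans (G.r_inv η).symm⟩, η),
      (G.d_mul _ _ _).trans (G.d_inv η)⟩ = ξ := by
  rw [G.mul_assoc ξ (G.inv η) η (h.trans (G.r_inv η).symm) (G.d_inv η)]
  have e := G.mul_unit ξ
  conv_rhs => rw [← e]
  congr 3
  rw [G.inv_mul, h]

theorem inv_unique (ξ η : Ξ) (h : G.d ξ = G.r η) (e : G.mul ⟨(ξ, η), h⟩ = G.unit (G.r ξ)) :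
    ξ = G.inv η := by
  have h1 := G.mul_inv_mul_cancel ξ η h
  have h2 := G.unit_mul (G.inv η)
  have h3 : G.r (G.inv η) = G.r ξ := by
    rw [G.r_inv, ← G.d_mul ξ η h, e, G.d_unit]
  conv_lhs => rw [← h1]
  conv_rhs => rw [← h2]
  congr 3
  rw [e, h3]

theorem inv_inv (ξ : Ξ) : G.inv (G.inv ξ) = ξ :=
  (G.inv_unique ξ (G.inv ξ) (G.r_inv ξ).symm (G.mul_inv ξ)).symm

theorem inv_div {x : X} (ξ η : G.Fiber x) : G.inv (G.div ξ η) = G.div η ξ := by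
  symm
  have h : G.d (G.div η ξ) = G.r (G.div ξ η) := by
    simp only [div, divPair]; rw [G.d_mul, G.r_mul, G.d_inv]
  have hξη : G.d ξ.1 = G.r (G.inv η.1) := by rw [G.r_inv, ξ.2, η.2]
  refine G.inv_unique _ _ h ?_
  have h1 := G.mul_assoc (G.div η ξ) ξ.1 (G.inv η.1)
    ((G.d_mul _ _ _).trans (G.d_inv ξ.1)) hξη
  have h2 := G.mul_mul_inv_cancel η.1 ξ.1 (η.2.trans ξ.2.symm)
  refine h1.symm.trans ?_
  have h3 : G.r (G.div η ξ) = G.r η.1 := G.r_mul _ _ _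
  rw [h3, ← G.mul_inv η.1]
  congr 3

theorem rightMul_div (ξ : Ξ) (ζ : G.Fiber (G.r ξ)) :
    G.div (G.rightMul ξ ζ) ⟨ξ, rfl⟩ = ζ.1 :=
  G.mul_inv_mul_cancel ζ.1 ξ ζ.2

theorem div_rightMul (ξ : Ξ) (ζ : G.Fiber (G.r ξ)) :
    G.div ⟨ξ, rfl⟩ (G.rightMul ξ ζ) = G.inv ζ.1 := by
  rw [← G.inv_div, G.rightMul_div]

theorem r_div {x : X} (ξ η : G.Fiber x) : G.r (G.div ξ η) = G.r ξ.1 := G.r_mul _ _ _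

theorem d_div {x : X} (ξ η : G.Fiber x) : G.d (G.div ξ η) = G.r η.1 :=
  (G.d_mul _ _ _).trans (G.d_inv _)

end Algebra

section Topology

theorem continuous_rightMul (ξ : Ξ) : Continuous (G.rightMul ξ) := by
  unfold rightMul
  refine Continuous.subtype_mk (G.continuous_mul.comp ?_) _
  fun_prop

theorem continuous_divPair (x : X) :
    Continuous fun p : G.Fiber x × G.Fiber x => G.divPair p.1 p.2 := by
  unfold divPair
  have := G.continuous_inv
  refine Continuous.subtype_mk (Continuous.prodMk (G.continuous_mul.comp ?_) ?_) _
  · refine Continuous.subtype_mk ?_ _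
    fun_prop
  · fun_prop

theorem continuous_div (x : X) :
    Continuous fun p : G.Fiber x × G.Fiber x => G.div p.1 p.2 :=
  continuous_fst.comp (continuous_subtype_val.comp (G.continuous_divPair x))

variable [T2Space Ξ]

theorem t2Space_units (G : TopologicalGroupoid Ξ X) : T2Space X :=
  T2Space.of_injective_continuous (Function.LeftInverse.injective G.d_unit) G.continuous_unit

theorem isClosed_fiber (x : X) : IsClosed {ξ | G.d ξ = x} := by
  have := G.t2Space_units
  exact isClosed_eq G.continuous_d continuous_const

theorem isClosed_composable : IsClosed {p : Ξ × Ξ | G.d p.1 = G.r p.2} := by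
  have := G.t2Space_units
  exact isClosed_eq (G.continuous_d.comp continuous_fst) (G.continuous_r.comp continuous_snd)

theorem locallyCompactSpace_fiber [LocallyCompactSpace Ξ] (x : X) :
    LocallyCompactSpace (G.Fiber x) :=
  (G.isClosed_fiber x).isClosedEmbedding_subtypeVal.locallyCompactSpace

theorem sigmaCompactSpace_fiber [SigmaCompactSpace Ξ] (x : X) :
    SigmaCompactSpace (G.Fiber x) :=
  (G.isClosed_fiber x).isClosedEmbedding_subtypeVal.sigmaCompactSpace

theorem isCompact_fiber_preimage (x : X) {K : Set Ξ} (hK : IsCompact K) :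
    IsCompact {η : G.Fiber x | η.1 ∈ K} :=
  (G.isClosed_fiber x).isClosedEmbedding_subtypeVal.isCompact_preimage hK

theorem exists_compact_of_div_mem (f : C_c(Ξ, ℂ)) {x : X} {U : Set (G.Fiber x)}
    (hU : IsCompact U) :
    ∃ K : Set (G.Fiber x), IsCompact K ∧ ∀ ξ η, η ∈ U → f (G.div ξ η) ≠ 0 → ξ ∈ K := by
  have hc : IsCompact ((fun p : G.Composable => p.1) ⁻¹' (tsupport f ×ˢ (Subtype.val '' U))) :=
    G.isClosed_composable.isClosedEmbedding_subtypeVal.isCompact_preimage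
      (f.hasCompactSupport.isCompact.prod (hU.image continuous_subtype_val))
  refine ⟨_, G.isCompact_fiber_preimage x (hc.image G.continuous_mul), fun ξ η hη h => ?_⟩
  refine ⟨G.divPair ξ η, ⟨subset_tsupport _ h, η, hη, rfl⟩, ?_⟩
  exact G.mul_mul_inv_cancel ξ.1 η.1 (ξ.2.trans η.2.symm)

theorem exists_compact_of_div_mem' (f : C_c(Ξ, ℂ)) {x : X} (ξ : G.Fiber x) :
    ∃ K : Set (G.Fiber x), IsCompact K ∧ ∀ η, f (G.div ξ η) ≠ 0 → η ∈ K := by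
  have hc : IsCompact ((fun p : G.Composable => p.1) ⁻¹'
      ((G.inv '' tsupport f) ×ˢ (Subtype.val '' ({ξ} : Set (G.Fiber x))))) :=
    G.isClosed_composable.isClosedEmbedding_subtypeVal.isCompact_preimage
      ((f.hasCompactSupport.isCompact.image G.continuous_inv).prod
        (isCompact_singleton.image continuous_subtype_val))
  refine ⟨_, G.isCompact_fiber_preimage x (hc.image G.continuous_mul), fun η h => ?_⟩
  refine ⟨G.divPair η ξ, ⟨⟨G.div ξ η, subset_tsupport _ h, G.inv_div ξ η⟩, ξ, rfl, rfl⟩, ?_⟩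
  exact G.mul_mul_inv_cancel η.1 ξ.1 (η.2.trans ξ.2.symm)

end Topology

section RegularRepresentation

attribute [instance] HaarSystem.regular HaarSystem.isOpenPosMeasure

set_option linter.unusedSectionVars false

variable {G}
variable [MeasurableSpace Ξ] (lam : G.HaarSystem) (ω : G.TwoCocycle)

/-- The Hilbert space `L²(Ξ_x; λ_x)`. -/
abbrev HilbertFiber (x : X) : Type u := Lp ℂ 2 (lam.measure x)

/-- The integral kernel `f(ξ η⁻¹) ω(ξ η⁻¹, η)` of a regular representation. -/
noncomputable def kernel (f : C_c(Ξ, ℂ)) {x : X} (ξ η : G.Fiber x) : ℂ :=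
  f (G.div ξ η) * (ω.toFun (G.divPair ξ η) : ℂ)

/-- The twisted convolution
`(f ⋆ u)(ξ) = ∫ f(ξ η⁻¹) u(η) ω(ξ η⁻¹, η) dλ_x(η)` of `f` with a function `u` on a fibre. -/
noncomputable def conv (f : C_c(Ξ, ℂ)) {x : X} (u : G.Fiber x → ℂ) (ξ : G.Fiber x) : ℂ :=
  ∫ η, f (G.div ξ η) * u η * (ω.toFun (G.divPair ξ η) : ℂ) ∂(lam.measure x)

variable [T2Space Ξ] [LocallyCompactSpace Ξ] [SigmaCompactSpace Ξ] [BorelSpace Ξ]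

theorem exists_integral_le (h : C_c(Ξ, ℂ)) :
    ∃ M : ℝ, ∀ y, ∫ ζ : G.Fiber y, ‖h ζ.1‖ ∂(lam.measure y) ≤ M := by
  have hcont : Continuous fun ζ : Ξ => ((‖h ζ‖ : ℝ) : ℂ) := by fun_prop
  have hsupp : HasCompactSupport fun ζ : Ξ => ((‖h ζ‖ : ℝ) : ℂ) :=
    h.hasCompactSupport.comp_left (g := fun z : ℂ => ((‖z‖ : ℝ) : ℂ)) (by simp)
  let g : C_c(Ξ, ℂ) := ⟨⟨_, hcont⟩, hsupp⟩
  have hc := lam.continuous_integral g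
  have hK : IsCompact (G.d '' tsupport h) := h.hasCompactSupport.isCompact.image G.continuous_d
  obtain ⟨C, hC⟩ := hK.exists_bound_of_continuousOn hc.continuousOn
  refine ⟨max C 0, fun y => ?_⟩
  by_cases hy : y ∈ G.d '' tsupport h
  · refine le_trans ?_ ((hC y hy).trans (le_max_left _ _))
    have : ∫ η : G.Fiber y, g η.1 ∂(lam.measure y)
        = ((∫ ζ : G.Fiber y, ‖h ζ.1‖ ∂(lam.measure y) : ℝ) : ℂ) := by
      rw [← integral_complex_ofReal]; rfl
    rw [this, Complex.norm_real]
    exact le_abs_self _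
  · have : ∀ ζ : G.Fiber y, ‖h ζ.1‖ = 0 := by
      intro ζ
      rw [norm_eq_zero]
      by_contra hne
      exact hy ⟨ζ.1, subset_tsupport _ hne, ζ.2⟩
    simp [this]

theorem integral_left (f : C_c(Ξ, ℂ)) {x : X} (ξ : G.Fiber x) :
    ∫ η, ‖f (G.div ξ η)‖ ∂(lam.measure x)
      = ∫ ζ : G.Fiber (G.r ξ.1), ‖f (G.inv ζ.1)‖ ∂(lam.measure (G.r ξ.1)) := by
  obtain ⟨ξ, rfl⟩ := ξ
  have hcont := G.continuous_div (G.d ξ)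
  rw [← lam.map_rightMul ξ, integral_map (G.continuous_rightMul ξ).aemeasurable]
  · simp only [div_rightMul]
  · have : Continuous fun η => ‖f (G.div (⟨ξ, rfl⟩ : G.Fiber (G.d ξ)) η)‖ := by fun_prop
    exact this.aestronglyMeasurable

theorem integral_right (f : C_c(Ξ, ℂ)) {x : X} (η : G.Fiber x) :
    ∫ ξ, ‖f (G.div ξ η)‖ ∂(lam.measure x)
      = ∫ ζ : G.Fiber (G.r η.1), ‖f ζ.1‖ ∂(lam.measure (G.r η.1)) := by
  obtain ⟨η, rfl⟩ := η
  have hcont := G.continuous_div (G.d η)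
  rw [← lam.map_rightMul η, integral_map (G.continuous_rightMul η).aemeasurable]
  · simp only [rightMul_div]
  · have : Continuous fun ξ => ‖f (G.div ξ (⟨η, rfl⟩ : G.Fiber (G.d η)))‖ := by fun_prop
    exact this.aestronglyMeasurable

theorem exists_schur_bound (f : C_c(Ξ, ℂ)) :
    ∃ M : ℝ, 0 < M ∧ ∀ x : X,
      (∀ ξ : G.Fiber x, ∫ η, ‖f (G.div ξ η)‖ ∂(lam.measure x) ≤ M) ∧
      (∀ η : G.Fiber x, ∫ ξ, ‖f (G.div ξ η)‖ ∂(lam.measure x) ≤ M) := by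
  obtain ⟨M₁, h₁⟩ := exists_integral_le lam f
  have hcont : Continuous fun ζ : Ξ => f (G.inv ζ) := (map_continuous f).comp G.continuous_inv
  have hsupp : HasCompactSupport fun ζ : Ξ => f (G.inv ζ) := by
    refine HasCompactSupport.intro (f.hasCompactSupport.isCompact.image G.continuous_inv) ?_
    intro ζ hζ
    by_contra hne
    exact hζ ⟨G.inv ζ, subset_tsupport _ hne, G.inv_inv ζ⟩
  obtain ⟨M₂, h₂⟩ := exists_integral_le lam (⟨⟨_, hcont⟩, hsupp⟩ : C_c(Ξ, ℂ))
  refine ⟨max (max M₁ M₂) 1, by positivity, fun x => ⟨fun ξ => ?_, fun η => ?_⟩⟩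
  · rw [integral_left]
    exact (h₂ _).trans ((le_max_right _ _).trans (le_max_left _ _))
  · rw [integral_right]
    exact (h₁ _).trans ((le_max_left _ _).trans (le_max_left _ _))

theorem continuous_kernel (f : C_c(Ξ, ℂ)) (x : X) :
    Continuous fun p : G.Fiber x × G.Fiber x => kernel ω f p.1 p.2 := by
  have h1 := G.continuous_div x
  have h2 := ω.continuous_toFun.comp (G.continuous_divPair x)
  exact ((map_continuous f).comp h1).mul (continuous_subtype_val.comp h2)

theorem norm_kernel (f : C_c(Ξ, ℂ)) {x : X} (ξ η : G.Fiber x) :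
    ‖kernel ω f ξ η‖ = ‖f (G.div ξ η)‖ := by
  rw [kernel, norm_mul, Circle.norm_coe, mul_one]

theorem hasCompactSupport_kernel (f : C_c(Ξ, ℂ)) {x : X} (ξ : G.Fiber x) :
    HasCompactSupport fun η => kernel ω f ξ η := by
  obtain ⟨K, hK, h⟩ := G.exists_compact_of_div_mem' f ξ
  refine HasCompactSupport.intro hK fun η hη => ?_
  have : f (G.div ξ η) = 0 := by
    by_contra hne
    exact hη (h η hne)
  simp [kernel, this]

theorem memLp_kernel (f : C_c(Ξ, ℂ)) {x : X} (ξ : G.Fiber x) (p : ℝ≥0∞) :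
    MemLp (fun η => kernel ω f ξ η) p (lam.measure x) :=
  Continuous.memLp_of_hasCompactSupport
    ((continuous_kernel ω f x).comp (Continuous.prodMk_right ξ)) (hasCompactSupport_kernel ω f ξ)

theorem conv_eq (f : C_c(Ξ, ℂ)) {x : X} (u : G.Fiber x → ℂ) (ξ : G.Fiber x) :
    conv lam ω f u ξ = ∫ η, kernel ω f ξ η * u η ∂(lam.measure x) := by
  simp only [conv, kernel]
  congr 1
  ext η
  ring

theorem integrable_kernel_mul (f : C_c(Ξ, ℂ)) {x : X} (ξ : G.Fiber x) {u : G.Fiber x → ℂ}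
    (hu : MemLp u 2 (lam.measure x)) :
    Integrable (fun η => kernel ω f ξ η * u η) (lam.measure x) :=
  (memLp_kernel lam ω f ξ 2).integrable_mul hu

/-- The Schur test for continuous compactly supported functions. -/
theorem conv_bound_of_compact (f : C_c(Ξ, ℂ)) {M : ℝ} (hM : 0 < M) {x : X}
    (h1 : ∀ ξ : G.Fiber x, ∫ η, ‖f (G.div ξ η)‖ ∂(lam.measure x) ≤ M)
    (h2 : ∀ η : G.Fiber x, ∫ ξ, ‖f (G.div ξ η)‖ ∂(lam.measure x) ≤ M)
    {u : G.Fiber x → ℂ} (hu : Continuous u) (hus : HasCompactSupport u) :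
    MemLp (conv lam ω f u) 2 (lam.measure x) ∧
      eLpNorm (conv lam ω f u) 2 (lam.measure x)
        ≤ ENNReal.ofReal M * eLpNorm u 2 (lam.measure x) := by
  have := G.locallyCompactSpace_fiber x
  obtain ⟨K, hK, hKf⟩ := G.exists_compact_of_div_mem f hus.isCompact
  set k : G.Fiber x → G.Fiber x → ℝ := fun ξ η => ‖f (G.div ξ η)‖ with hk
  have hkc : Continuous fun p : G.Fiber x × G.Fiber x => k p.1 p.2 :=
    ((map_continuous f).comp (G.continuous_div x)).norm
  have hk0 : ∀ ξ η, 0 ≤ k ξ η := fun _ _ => norm_nonneg _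
  have hzero : ∀ ξ η, ξ ∉ K → ‖f (G.div ξ η)‖ * ‖u η‖ = 0 := by
    intro ξ η hξ
    by_contra hne
    have hfn : f (G.div ξ η) ≠ 0 := by
      rintro h; simp [h] at hne
    have hun : u η ≠ 0 := by
      rintro h; simp [h] at hne
    exact hξ (hKf ξ η (subset_tsupport _ hun) hfn)
  -- continuity and compact support of the convolution
  have hwc : Continuous (conv lam ω f u) := by
    rw [← continuousOn_univ]
    have e : conv lam ω f u = fun ξ => ∫ η, kernel ω f ξ η * u η ∂(lam.measure x) :=
      funext fun ξ => conv_eq lam ω f u ξ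
    rw [e]
    refine continuousOn_integral_of_compact_support hus.isCompact ?_ ?_
    · exact ((continuous_kernel ω f x).mul (hu.comp continuous_snd)).continuousOn
    · intro p η _ hη
      simp [image_eq_zero_of_notMem_tsupport hη]
  have hws : HasCompactSupport (conv lam ω f u) := by
    refine HasCompactSupport.intro hK fun ξ hξ => ?_
    rw [conv_eq]
    refine integral_eq_zero_of_ae (Eventually.of_forall fun η => ?_)
    have := hzero ξ η hξ
    rw [← norm_kernel ω, ← norm_mul, norm_eq_zero] at this
    exact this
  have hwm : MemLp (conv lam ω f u) 2 (lam.measure x) := hwc.memLp_of_hasCompactSupport hws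
  refine ⟨hwm, ?_⟩
  -- the squared estimate
  have hum : MemLp u 2 (lam.measure x) := hu.memLp_of_hasCompactSupport hus
  set F : G.Fiber x → G.Fiber x → ℝ := fun ξ η => k ξ η * ‖u η‖ ^ 2 with hF
  have hFc : Continuous F.uncurry := hkc.mul ((hu.comp continuous_snd).norm.pow 2)
  have hFs : HasCompactSupport F.uncurry := by
    refine HasCompactSupport.intro (hK.prod hus.isCompact) ?_
    rintro ⟨ξ, η⟩ hp
    simp only [Function.uncurry, hF]
    by_cases hη : η ∈ tsupport u
    · have hξ : ξ ∉ K := fun h => hp ⟨h, hη⟩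
      have := hzero ξ η hξ
      rw [pow_two, ← _root_.mul_assoc, hk, this, zero_mul]
    · simp [image_eq_zero_of_notMem_tsupport hη]
  have hki : ∀ ξ, Integrable (k ξ) (lam.measure x) := fun ξ => by
    have := (memLp_one_iff_integrable.1 (memLp_kernel lam ω f ξ 1)).norm
    simpa only [norm_kernel] using this
  have hsec : ∀ (ξ) (n : ℕ), 0 < n → Integrable (fun η => k ξ η * ‖u η‖ ^ n) (lam.measure x) := by
    intro ξ n hn
    refine Continuous.integrable_of_hasCompactSupport ?_ ?_
    · exact (hkc.comp (Continuous.prodMk_right ξ)).mul (hu.norm.pow n)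
    · refine HasCompactSupport.intro hus.isCompact fun η hη => ?_
      simp [image_eq_zero_of_notMem_tsupport hη, hn.ne']
  have hpt : ∀ ξ, ‖conv lam ω f u ξ‖ ^ 2 ≤ M * ∫ η, F ξ η ∂(lam.measure x) := by
    intro ξ
    set A : ℝ := ∫ η, k ξ η * ‖u η‖ ∂(lam.measure x) with hA
    have hA0 : 0 ≤ A := integral_nonneg fun η => mul_nonneg (hk0 _ _) (norm_nonneg _)
    have hle : ‖conv lam ω f u ξ‖ ≤ A := by
      rw [conv_eq]
      refine (norm_integral_le_integral_norm _).trans_eq ?_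
      simp only [norm_mul, norm_kernel, hA, hk]
    have hi1 : Integrable (fun η => k ξ η * ‖u η‖) (lam.measure x) := by
      simpa using hsec ξ 1 one_pos
    have hi2 : Integrable (fun η => F ξ η) (lam.measure x) := hsec ξ 2 two_pos
    have hq : 0 ≤ ∫ η, k ξ η * (‖u η‖ - A / M) ^ 2 ∂(lam.measure x) :=
      integral_nonneg fun η => mul_nonneg (hk0 _ _) (sq_nonneg _)
    have hexp : ∫ η, k ξ η * (‖u η‖ - A / M) ^ 2 ∂(lam.measure x)
        = (∫ η, F ξ η ∂(lam.measure x)) - 2 * (A / M) * A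
          + (A / M) ^ 2 * ∫ η, k ξ η ∂(lam.measure x) := by
      have e1 : ∀ η, k ξ η * (‖u η‖ - A / M) ^ 2
          = F ξ η - 2 * (A / M) * (k ξ η * ‖u η‖) + (A / M) ^ 2 * k ξ η := fun η => by
        simp only [hF]; ring
      simp only [e1]
      have i1 : Integrable (fun η => 2 * (A / M) * (k ξ η * ‖u η‖)) (lam.measure x) :=
        hi1.const_mul _
      have i2 : Integrable (fun η => F ξ η - 2 * (A / M) * (k ξ η * ‖u η‖)) (lam.measure x) :=
        hi2.sub i1
      rw [integral_add i2 ((hki ξ).const_mul _), integral_sub hi2 i1, integral_const_mul,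
        integral_const_mul]
    have hb : (A / M) ^ 2 * ∫ η, k ξ η ∂(lam.measure x) ≤ (A / M) ^ 2 * M :=
      mul_le_mul_of_nonneg_left (h1 ξ) (sq_nonneg _)
    have hfin : A ^ 2 / M ≤ ∫ η, F ξ η ∂(lam.measure x) := by
      have e1 : 2 * (A / M) * A = 2 * (A ^ 2 / M) := by ring
      have e2 : (A / M) ^ 2 * M = A ^ 2 / M := by field_simp
      rw [hexp, e1] at hq
      rw [e2] at hb
      linarith
    calc ‖conv lam ω f u ξ‖ ^ 2 ≤ A ^ 2 := by gcongr
      _ ≤ M * ∫ η, F ξ η ∂(lam.measure x) := by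
        rw [div_le_iff₀ hM] at hfin
        linarith
  have hFi : Integrable (fun ξ => ∫ η, F ξ η ∂(lam.measure x)) (lam.measure x) := by
    refine Continuous.integrable_of_hasCompactSupport ?_ ?_
    · rw [← continuousOn_univ]
      refine continuousOn_integral_of_compact_support hus.isCompact hFc.continuousOn ?_
      intro p η _ hη
      simp [hF, image_eq_zero_of_notMem_tsupport hη]
    · refine HasCompactSupport.intro hK fun ξ hξ => ?_
      refine integral_eq_zero_of_ae (Eventually.of_forall fun η => ?_)
      simp only [hF, Pi.zero_apply]
      rw [pow_two, ← _root_.mul_assoc, hk, hzero ξ η hξ, zero_mul]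
  have hu2 : Integrable (fun η => ‖u η‖ ^ 2) (lam.measure x) :=
    (memLp_two_iff_integrable_sq_norm hum.1).1 hum
  have hw2 : Integrable (fun η => ‖conv lam ω f u η‖ ^ 2) (lam.measure x) :=
    (memLp_two_iff_integrable_sq_norm hwm.1).1 hwm
  have hmain : ∫ ξ, ‖conv lam ω f u ξ‖ ^ 2 ∂(lam.measure x)
      ≤ M ^ 2 * ∫ η, ‖u η‖ ^ 2 ∂(lam.measure x) := by
    calc ∫ ξ, ‖conv lam ω f u ξ‖ ^ 2 ∂(lam.measure x)
        ≤ ∫ ξ, M * ∫ η, F ξ η ∂(lam.measure x) ∂(lam.measure x) :=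
          integral_mono hw2 (hFi.const_mul M) hpt
      _ = M * ∫ η, ∫ ξ, F ξ η ∂(lam.measure x) ∂(lam.measure x) := by
          rw [integral_const_mul, integral_integral_swap_of_hasCompactSupport hFc hFs]
      _ ≤ M * ∫ η, M * ‖u η‖ ^ 2 ∂(lam.measure x) := by
          refine mul_le_mul_of_nonneg_left ?_ hM.le
          refine integral_mono_of_nonneg (Eventually.of_forall fun η => ?_)
            (hu2.const_mul M) (Eventually.of_forall fun η => ?_)
          · exact integral_nonneg fun ξ => mul_nonneg (hk0 _ _) (sq_nonneg _)
          · simp only [hF]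
            rw [integral_mul_const]
            exact mul_le_mul_of_nonneg_right (h2 η) (sq_nonneg _)
      _ = M ^ 2 * ∫ η, ‖u η‖ ^ 2 ∂(lam.measure x) := by
          rw [integral_const_mul]; ring
  have e (v : G.Fiber x → ℂ) (hv : MemLp v 2 (lam.measure x)) :
      eLpNorm v 2 (lam.measure x)
        = ENNReal.ofReal (Real.sqrt (∫ η, ‖v η‖ ^ 2 ∂(lam.measure x))) := by
    rw [hv.eLpNorm_eq_integral_rpow_norm two_ne_zero ENNReal.ofNat_ne_top, Real.sqrt_eq_rpow]
    simp
  rw [e _ hwm, e _ hum, ← ENNReal.ofReal_mul hM.le]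
  refine ENNReal.ofReal_le_ofReal ?_
  refine (Real.sqrt_le_sqrt hmain).trans_eq ?_
  rw [Real.sqrt_mul (sq_nonneg M), Real.sqrt_sq hM.le]

/-- The Schur test for square integrable functions. -/
theorem conv_bound (f : C_c(Ξ, ℂ)) {M : ℝ} (hM : 0 < M) {x : X}
    (h1 : ∀ ξ : G.Fiber x, ∫ η, ‖f (G.div ξ η)‖ ∂(lam.measure x) ≤ M)
    (h2 : ∀ η : G.Fiber x, ∫ ξ, ‖f (G.div ξ η)‖ ∂(lam.measure x) ≤ M)
    (u : HilbertFiber lam x) :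
    MemLp (conv lam ω f u) 2 (lam.measure x) ∧
      eLpNorm (conv lam ω f u) 2 (lam.measure x)
        ≤ ENNReal.ofReal M * eLpNorm u 2 (lam.measure x) := by
  have := G.locallyCompactSpace_fiber x
  have := G.sigmaCompactSpace_fiber x
  have hum := Lp.memLp u
  have hseq : ∀ n : ℕ, ∃ g : G.Fiber x → ℂ, HasCompactSupport g ∧
      eLpNorm ((u : G.Fiber x → ℂ) - g) 2 (lam.measure x) ≤ ((n : ℝ≥0∞) + 1)⁻¹ ∧ Continuous g ∧
        MemLp g 2 (lam.measure x) := fun n =>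
    hum.exists_hasCompactSupport_eLpNorm_sub_le ENNReal.ofNat_ne_top (by simp)
  choose g hgs hgn hgc hgm using hseq
  have hlim : Tendsto (fun n => eLpNorm ((u : G.Fiber x → ℂ) - g n) 2 (lam.measure x)) atTop
      (𝓝 0) := by
    refine tendsto_of_tendsto_of_tendsto_of_le_of_le tendsto_const_nhds ?_ (fun _ => zero_le) hgn
    have := (tendsto_add_atTop_iff_nat 1).2 ENNReal.tendsto_inv_nat_nhds_zero
    simpa using this
  have hptw : ∀ ξ, Tendsto (fun n => conv lam ω f (g n) ξ) atTop (𝓝 (conv lam ω f u ξ)) := by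
    intro ξ
    have hkm := memLp_kernel lam ω f ξ 2
    simp only [conv_eq]
    rw [tendsto_iff_norm_sub_tendsto_zero]
    have hz : Tendsto (fun n => (eLpNorm (fun η => kernel ω f ξ η) 2 (lam.measure x)
        * eLpNorm ((u : G.Fiber x → ℂ) - g n) 2 (lam.measure x)).toReal) atTop (𝓝 0) := by
      have h3 := ENNReal.Tendsto.const_mul (a := eLpNorm (fun η => kernel ω f ξ η) 2
        (lam.measure x)) hlim (Or.inr hkm.2.ne)
      rw [mul_zero] at h3
      exact (ENNReal.tendsto_toReal ENNReal.zero_ne_top).comp h3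
    refine squeeze_zero (fun _ => norm_nonneg _) (fun n => ?_) hz
    rw [← integral_sub (integrable_kernel_mul lam ω f ξ (hgm n))
      (integrable_kernel_mul lam ω f ξ hum), ← toReal_enorm]
    refine ENNReal.toReal_mono (ENNReal.mul_ne_top hkm.2.ne (hum.sub (hgm n)).2.ne) ?_
    refine (enorm_integral_le_lintegral_enorm _).trans ?_
    rw [← eLpNorm_one_eq_lintegral_enorm]
    have h4 := eLpNorm_smul_le_mul_eLpNorm (p := 2) (q := 2) (r := 1) (hum.sub (hgm n)).1 hkm.1
    refine le_trans (le_of_eq ?_) h4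
    rw [← eLpNorm_neg]
    congr 1
    ext η
    simp only [Pi.neg_apply, Pi.smul_apply', Pi.sub_apply, smul_eq_mul]
    ring
  have hb : ∀ n, MemLp (conv lam ω f (g n)) 2 (lam.measure x) ∧ _ := fun n =>
    conv_bound_of_compact lam ω f hM h1 h2 (hgc n) (hgs n)
  have hmeas : AEStronglyMeasurable (conv lam ω f u) (lam.measure x) :=
    aestronglyMeasurable_of_tendsto_ae atTop (fun n => (hb n).1.1) (Eventually.of_forall hptw)
  have hle : eLpNorm (conv lam ω f u) 2 (lam.measure x)
      ≤ ENNReal.ofReal M * eLpNorm u 2 (lam.measure x) := by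
    refine (Lp.eLpNorm_lim_le_liminf_eLpNorm (fun n => (hb n).1.1) _
      (Eventually.of_forall hptw)).trans ?_
    have hup : Tendsto (fun n => ENNReal.ofReal M * (eLpNorm u 2 (lam.measure x)
        + eLpNorm ((u : G.Fiber x → ℂ) - g n) 2 (lam.measure x))) atTop
        (𝓝 (ENNReal.ofReal M * (eLpNorm u 2 (lam.measure x) + 0))) :=
      ENNReal.Tendsto.const_mul (tendsto_const_nhds.add hlim) (Or.inr ENNReal.ofReal_ne_top)
    rw [add_zero] at hup
    rw [← hup.liminf_eq]
    refine liminf_le_liminf (Eventually.of_forall fun n => ?_)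
    refine (hb n).2.trans ?_
    gcongr
    have e : g n = (u : G.Fiber x → ℂ) - ((u : G.Fiber x → ℂ) - g n) := by simp
    conv_lhs => rw [e]
    exact eLpNorm_sub_le hum.1 (hum.sub (hgm n)).1 one_le_two
  exact ⟨⟨hmeas, hle.trans_lt (ENNReal.mul_lt_top ENNReal.ofReal_lt_top hum.2)⟩, hle⟩

theorem memLp_conv (f : C_c(Ξ, ℂ)) {x : X} (u : HilbertFiber lam x) :
    MemLp (conv lam ω f u) 2 (lam.measure x) := by
  obtain ⟨M, hM, h⟩ := exists_schur_bound lam f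
  exact (conv_bound lam ω f hM (h x).1 (h x).2 u).1

/-- The operator `u ↦ f ⋆ u` on `L²(Ξ_x; λ_x)`, as a linear map. -/
noncomputable def regularLinear (x : X) (f : C_c(Ξ, ℂ)) :
    HilbertFiber lam x →ₗ[ℂ] HilbertFiber lam x where
  toFun u := (memLp_conv lam ω f u).toLp (conv lam ω f u)
  map_add' u v := by
    rw [← MemLp.toLp_add]
    congr 1
    ext ξ
    simp only [Pi.add_apply, conv_eq]
    rw [← integral_add (integrable_kernel_mul lam ω f ξ (Lp.memLp u))
      (integrable_kernel_mul lam ω f ξ (Lp.memLp v))]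
    refine integral_congr_ae ?_
    filter_upwards [Lp.coeFn_add u v] with η hη
    rw [hη, Pi.add_apply, mul_add]
  map_smul' c u := by
    rw [RingHom.id_apply, ← MemLp.toLp_const_smul]
    congr 1
    ext ξ
    simp only [Pi.smul_apply, conv_eq]
    rw [← integral_smul]
    refine integral_congr_ae ?_
    filter_upwards [Lp.coeFn_smul c u] with η hη
    rw [hη, Pi.smul_apply, smul_eq_mul, smul_eq_mul]
    ring

theorem exists_norm_regularLinear_le (f : C_c(Ξ, ℂ)) :
    ∃ M : ℝ, 0 ≤ M ∧ ∀ (x : X) (u : HilbertFiber lam x), ‖regularLinear lam ω x f u‖ ≤ M * ‖u‖ := by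
  obtain ⟨M, hM, h⟩ := exists_schur_bound lam f
  refine ⟨M, hM.le, fun x u => ?_⟩
  have hb := (conv_bound lam ω f hM (h x).1 (h x).2 u).2
  change ‖(memLp_conv lam ω f u).toLp (conv lam ω f u)‖ ≤ M * ‖u‖
  have e : M * ‖u‖ = (ENNReal.ofReal M * eLpNorm u 2 (lam.measure x)).toReal := by
    rw [ENNReal.toReal_mul, ENNReal.toReal_ofReal hM.le, Lp.norm_def]
  rw [Lp.norm_toLp, e]
  exact ENNReal.toReal_mono (ENNReal.mul_ne_top ENNReal.ofReal_ne_top (Lp.eLpNorm_ne_top u)) hb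

/-- The regular representation `Π_x(f) u = f ⋆ u` of continuous compactly supported functions. -/
noncomputable def regular (x : X) (f : C_c(Ξ, ℂ)) :
    HilbertFiber lam x →L[ℂ] HilbertFiber lam x :=
  (regularLinear lam ω x f).mkContinuousOfExistsBound
    ((exists_norm_regularLinear_le lam ω f).imp fun _ h => h.2 x)

theorem memℓp_regular (f : C_c(Ξ, ℂ)) : Memℓp (fun x => regular lam ω x f) ∞ := by
  obtain ⟨M, hM0, hM⟩ := exists_norm_regularLinear_le lam ω f
  refine memℓp_infty ⟨M, ?_⟩
  rintro _ ⟨x, rfl⟩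
  exact ContinuousLinearMap.opNorm_le_bound _ hM0 (hM x)

/-- The family `(Π_x(f))_x`, in the `C*`-algebra of bounded families of operators. Its norm is the
reduced norm `sup_x ‖Π_x(f)‖` of `f`. -/
noncomputable def regularFamily (f : C_c(Ξ, ℂ)) :
    lp (fun x => HilbertFiber lam x →L[ℂ] HilbertFiber lam x) ∞ :=
  ⟨fun x => regular lam ω x f, memℓp_regular lam ω f⟩

/-- The reduced twisted groupoid `C*`-algebra: the completion of `C_c(Ξ)` in the reduced norm
`sup_x ‖Π_x(f)‖`, realized as the `C*`-algebra generated by the families `(Π_x(f))_x`. (Since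
`Π_x(f) Π_x(g) = Π_x(f ⋆ g)` and `Π_x(f)* = Π_x(f^⋆)` for the twisted convolution and involution
of `C_c(Ξ)`, the families `(Π_x(f))_x` already form a `*`-algebra, isometric to `C_c(Ξ)` with the
reduced norm, and taking its closure in a complete space is completing it.) -/
abbrev ReducedAlgebra : Type u :=
  MultiplierExtension.generated (Set.range (regularFamily lam ω))

/-- The regular representation `Π_x` of the reduced twisted groupoid `C*`-algebra. -/
noncomputable def regularRep (x : X) :
    ReducedAlgebra lam ω →⋆ₙₐ[ℂ] (HilbertFiber lam x →L[ℂ] HilbertFiber lam x) :=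
  MultiplierExtension.eval (Set.range (regularFamily lam ω)) x

/-- The operator `H_x = Π_x^M(F)` defined by an element `F` of the multiplier algebra of the
reduced twisted groupoid `C*`-algebra. -/
noncomputable def multiplierOperator (F : 𝓜(ℂ, ReducedAlgebra lam ω)) (x : X) :
    HilbertFiber lam x →L[ℂ] HilbertFiber lam x :=
  MultiplierExtension.extension (regularRep lam ω x) F

end RegularRepresentation

end TopologicalGroupoid

/-!
The operators `H_x` are the values at one multiplier `F` of unital `*`-morphisms
`Π_x^M : 𝓜(A) → 𝔹(ℋ_x)`, where `A` is the reduced algebra. Two unital `*`-morphisms `φ, ψ` with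
`‖φ(P)‖ = ‖ψ(P)‖` for all `P` give elements with the same spectral set: on the closure of
`{(φ(P), ψ(P))}` in the product algebra both coordinate projections are isometric, hence injective
(`CStarSpectralSet.toFun_eq_of_norm_eq`). An approximate unit reduces equality of the norms on
`𝓜(A)` to equality of the norms on `A` (`Nondegenerate.norm_extension_mono`). So it remains to see
that `‖Π_x(a)‖ = ‖Π_y(a)‖` for `a` in `A` when `x` and `y` generate the same orbit closure, and that
the `Π_x` are nondegenerate, without which `Π_x^M` would not be unital.

For the norms, `‖Π_y(a)‖ ≤ ‖Π_x(a)‖` holds whenever `y` is in the closure of the orbit of `x`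
(`norm_regularRep_le_of_mem_orbitClosure`). Along an orbit the norm is constant, as a right
translation, corrected by a phase given by the cocycle, intertwines the representations
(`translation_regularRep`). To pass to the closure, restrict functions `g` in `C_c(Ξ)` to the
fibres: these restrictions `g_z` are dense in `L²(Ξ_z; λ_z)`, and `z ↦ ‖Π_z(a) g_z‖` is continuous.
For `a = f` in `C_c(Ξ)` the latter holds because `Π_z(f) g_z` is the restriction of the twisted
convolution `f ⋆ g`, again in `C_c(Ξ)` (`exists_convolution`); for general `a` the sections
`Π_z(a) g_z` are uniform limits of such restrictions.

Nondegeneracy (`nondegenerate_regularRep`) is seen by evaluating the continuous functions `f ⋆ u` at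
the unit of a fibre. In the minimal case every point is generic, since closures of orbits are
invariant; this uses that a Haar system makes the source map open (`HaarSystem.isOpenMap_d`).
-/

/-! ### Extension of nondegenerate representations to multipliers -/

namespace MultiplierExtension

section Extension

variable {A : Type*} [NonUnitalCStarAlgebra A]
variable {H : Type*} [NormedAddCommGroup H] [InnerProductSpace ℂ H] [CompleteSpace H]

/-- A representation is nondegenerate if it annihilates no nonzero vector. -/
def Nondegenerate (π : A →⋆ₙₐ[ℂ] (H →L[ℂ] H)) : Prop := ∀ v, (∀ a, π a v = 0) → v = 0

variable {π : A →⋆ₙₐ[ℂ] (H →L[ℂ] H)}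

theorem extension_apply (F : 𝓜(ℂ, A)) (a : A) (v : H) :
    extension π F (π a v) = π (F.fst a) v :=
  DFunLike.congr_fun ((existsUnique_extension π F).choose_spec.1.1 a) v

/-- For a nondegenerate representation, the extension to a multiplier `F` is determined by
`T π(a) = π(F a)`. -/
theorem Nondegenerate.eq_extension (hπ : Nondegenerate π) {F : 𝓜(ℂ, A)} {T : H →L[ℂ] H}
    (hT : ∀ a v, T (π a v) = π (F.fst a) v) : T = extension π F := by
  refine (existsUnique_extension π F).choose_spec.2 T ⟨fun a => ?_, fun v hv => ?_⟩
  · ext v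
    exact hT a v
  · rw [hπ v hv, map_zero]

/-- The vectors `π(a) v` span a dense subspace for a nondegenerate representation. -/
theorem Nondegenerate.eq_top_of_mem (hπ : Nondegenerate π) (W : Submodule ℂ H)
    (hW : IsClosed (W : Set H)) (h : ∀ a v, π a v ∈ W) : W = ⊤ :=
  MultiplierExtension.eq_top_of_mem π W hW h fun v hv => by rw [hπ v hv]; exact W.zero_mem

theorem Nondegenerate.inner_extension_star (hπ : Nondegenerate π) (F : 𝓜(ℂ, A)) (v w : H) :
    inner ℂ (extension π (star F) v) w = inner ℂ v (extension π F w) := by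
  -- both sides are closed conditions, so it suffices to compute on vectors `π(a) v` and `π(b) w`
  have key : ∀ (a b : A) (v w : H), inner ℂ (extension π (star F) (π a v)) (π b w)
      = inner ℂ (π a v) (extension π F (π b w)) := fun a b v w => by
    rw [extension_apply, extension_apply, DoubleCentralizer.star_fst, map_star,
      ContinuousLinearMap.star_eq_adjoint, ContinuousLinearMap.adjoint_inner_left,
      ← ContinuousLinearMap.adjoint_inner_right (π a), ← ContinuousLinearMap.star_eq_adjoint,
      ← map_star, ← mul_apply_eq_comp, ← mul_apply_eq_comp, ← map_mul,
      ← map_mul, F.central]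
  have h1 : ∀ (b : A) (w v : H), inner ℂ (extension π (star F) v) (π b w)
      = inner ℂ v (extension π F (π b w)) := fun b w v => by
    let φ : H →L⋆[ℂ] ℂ := ((innerSL ℂ).flip (π b w)).comp (extension π (star F))
      - (innerSL ℂ).flip (extension π F (π b w))
    have hφ : φ.ker = ⊤ := hπ.eq_top_of_mem _ φ.isClosed_ker fun a v => by
      simp [φ, key]
    have : v ∈ φ.ker := hφ ▸ Submodule.mem_top
    simpa [φ, sub_eq_zero] using this
  let φ : H →L[ℂ] ℂ := innerSL ℂ (extension π (star F) v) - (innerSL ℂ v).comp (extension π F)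
  have hφ : φ.ker = ⊤ := hπ.eq_top_of_mem _ φ.isClosed_ker fun a w => by
    simp [φ, h1]
  have : w ∈ φ.ker := hφ ▸ Submodule.mem_top
  simpa [φ, sub_eq_zero] using this

/-- The extension of a nondegenerate representation, as a unital `*`-morphism. -/
noncomputable def Nondegenerate.extensionHom (hπ : Nondegenerate π) :
    𝓜(ℂ, A) →⋆ₐ[ℂ] (H →L[ℂ] H) where
  toFun := extension π
  map_one' := (hπ.eq_extension fun a v => by simp).symm
  map_mul' F F' := (hπ.eq_extension fun a v => by simp [extension_apply]).symm
  map_zero' := (hπ.eq_extension fun a v => by simp).symm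
  map_add' F F' := (hπ.eq_extension fun a v => by simp [extension_apply]).symm
  commutes' c := (hπ.eq_extension fun a v => by
    simp [Algebra.algebraMap_eq_smul_one]).symm
  map_star' F := by
    rw [ContinuousLinearMap.star_eq_adjoint]
    exact (ContinuousLinearMap.eq_adjoint_iff _ _).2 (hπ.inner_extension_star F)

/-- If `‖π(a)‖ ≤ C` for all `a` of the form `F e` with `‖e‖ ≤ 1`, then the extension of `F` has
norm at most `C`: this is seen by letting `e` run through an approximate unit. -/
theorem Nondegenerate.norm_extension_le (hπ : Nondegenerate π) (F : 𝓜(ℂ, A)) {C : ℝ}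
    (hC : 0 ≤ C) (h : ∀ e : A, ‖e‖ ≤ 1 → ‖π (F.fst e)‖ ≤ C) : ‖extension π F‖ ≤ C := by
  let _ := CStarAlgebra.spectralOrder A
  let _ := CStarAlgebra.spectralOrderedRing A
  have hau := CStarAlgebra.increasingApproximateUnit A
  set l := CStarAlgebra.approximateUnit A with hl
  let W : Submodule ℂ H :=
    { carrier := {v | Tendsto (fun e => π e v) l (𝓝 v)}
      add_mem' := fun hw hw' => by
        simpa only [Set.mem_ofPred_eq, map_add] using Tendsto.add hw hw'
      zero_mem' := by simp
      smul_mem' := fun c v hv => by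
        simpa only [Set.mem_ofPred_eq, map_smul] using Tendsto.const_smul hv c }
  have hW : W.topologicalClosure = ⊤ :=
    hπ.eq_top_of_mem _ W.isClosed_topologicalClosure fun a v => W.le_topologicalClosure <| by
      have h2 : Continuous fun b => π b v :=
        (ContinuousLinearMap.apply ℂ H v).continuous.comp (map_continuous π)
      refine ((h2.tendsto a).comp (hau.tendsto_mul_right a)).congr fun e => ?_
      simp
  refine ContinuousLinearMap.opNorm_le_bound _ hC fun v => ?_
  have hv : v ∈ closure (W : Set H) := by
    rw [← Submodule.topologicalClosure_coe, hW]; trivial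
  refine closure_minimal (fun v (hv : Tendsto (fun e => π e v) l (𝓝 v)) => ?_)
    (isClosed_le (by fun_prop) (by fun_prop) :
      IsClosed {v | ‖extension π F v‖ ≤ C * ‖v‖}) hv
  refine le_of_tendsto (((extension π F).continuous.tendsto v).comp hv).norm ?_
  filter_upwards [hau.eventually_norm] with e he
  simp only [Function.comp_apply, extension_apply]
  exact (ContinuousLinearMap.le_opNorm _ _).trans (by gcongr; exact h e he)

variable {K : Type*} [NormedAddCommGroup K] [InnerProductSpace ℂ K] [CompleteSpace K]
variable {ρ : A →⋆ₙₐ[ℂ] (K →L[ℂ] K)}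

theorem Nondegenerate.norm_extension_mono (hπ : Nondegenerate π)
    (h : ∀ a, ‖π a‖ ≤ ‖ρ a‖) (F : 𝓜(ℂ, A)) : ‖extension π F‖ ≤ ‖extension ρ F‖ := by
  refine hπ.norm_extension_le F (norm_nonneg _) fun e he => (h _).trans ?_
  have : ρ (F.fst e) = extension ρ F ∘L ρ e := by
    ext v
    simp [extension_apply]
  rw [this]
  refine (ContinuousLinearMap.opNorm_comp_le _ _).trans (mul_le_of_le_one_right (norm_nonneg _) ?_)
  exact (NonUnitalStarAlgHom.norm_apply_le ρ e).trans he

end Extension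

end MultiplierExtension

/-! ### Spectral sets -/

namespace CStarSpectralSet

/-- Two unital representations of a `C*`-algebra with the same norms send each element to
elements with the same spectral set. Both images are images of one element of the closure of
`{(φ a, ψ a)}` under the two coordinate projections, which are isometric on that closure. -/
theorem toFun_eq_of_norm_eq (S : CStarSpectralSet.{u}) {M E F : Type u} [CStarAlgebra M]
    [CStarAlgebra E] [CStarAlgebra F] (φ : M →⋆ₐ[ℂ] E) (ψ : M →⋆ₐ[ℂ] F)
    (h : ∀ a, ‖φ a‖ = ‖ψ a‖) (a : M) : S.toFun E (φ a) = S.toFun F (ψ a) := by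
  let R : StarSubalgebra ℂ (E × F) := (φ.prod ψ).range.topologicalClosure
  have : IsClosed (R : Set (E × F)) := StarSubalgebra.isClosed_topologicalClosure _
  have hR : ∀ p : R, ‖p.1.1‖ = ‖p.1.2‖ := fun p => by
    refine closure_minimal ?_ (isClosed_eq (by fun_prop) (by fun_prop) :
      IsClosed {p : E × F | ‖p.1‖ = ‖p.2‖}) p.2
    rintro _ ⟨b, rfl⟩
    exact h b
  let T : R := ⟨(φ a, ψ a), StarSubalgebra.le_topologicalClosure _ ⟨a, rfl⟩⟩
  let p₁ : R →⋆ₐ[ℂ] E := (StarAlgHom.fst ℂ E F).comp R.subtype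
  let p₂ : R →⋆ₐ[ℂ] F := (StarAlgHom.snd ℂ E F).comp R.subtype
  have h₁ : Function.Injective p₁ := (injective_iff_map_eq_zero p₁).2 fun p hp => by
    have hp1 : p.1.1 = 0 := hp
    have hp2 := hR p
    rw [hp1, norm_zero, eq_comm, norm_eq_zero] at hp2
    exact Subtype.ext (Prod.ext hp1 hp2)
  have h₂ : Function.Injective p₂ := (injective_iff_map_eq_zero p₂).2 fun p hp => by
    have hp2 : p.1.2 = 0 := hp
    have hp1 := hR p
    rw [hp2, norm_zero, norm_eq_zero] at hp1
    exact Subtype.ext (Prod.ext hp1 hp2)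
  exact (S.map_eq_of_injective R E p₁ h₁ T).trans (S.map_eq_of_injective R F p₂ h₂ T).symm

theorem toFun_extension_eq (S : CStarSpectralSet.{u}) {A H K : Type u} [NonUnitalCStarAlgebra A]
    [NormedAddCommGroup H] [InnerProductSpace ℂ H] [CompleteSpace H]
    [NormedAddCommGroup K] [InnerProductSpace ℂ K] [CompleteSpace K]
    {π : A →⋆ₙₐ[ℂ] (H →L[ℂ] H)} {ρ : A →⋆ₙₐ[ℂ] (K →L[ℂ] K)}
    (hπ : MultiplierExtension.Nondegenerate π) (hρ : MultiplierExtension.Nondegenerate ρ)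
    (h : ∀ a, ‖π a‖ = ‖ρ a‖) (F : 𝓜(ℂ, A)) :
    S.toFun _ (MultiplierExtension.extension π F) =
      S.toFun _ (MultiplierExtension.extension ρ F) :=
  S.toFun_eq_of_norm_eq hπ.extensionHom hρ.extensionHom (fun F => le_antisymm
    (hπ.norm_extension_mono (fun a => (h a).le) F)
    (hρ.norm_extension_mono (fun a => (h a).ge) F)) F

end CStarSpectralSet

/-! ### Induction on generated algebras -/

namespace MultiplierExtension

variable {I : Type*} {A : I → Type*} [∀ i, NonUnitalCStarAlgebra (A i)]

/-- A property of bounded families that holds on a `*`-closed set, and is stable under the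
algebraic operations and under limits, holds on the `C*`-algebra generated by that set. -/
theorem generated_induction {s : Set (lp A ∞)} (hs : ∀ a ∈ s, star a ∈ s) {P : lp A ∞ → Prop}
    (mem : ∀ a ∈ s, P a) (zero : P 0) (add : ∀ a b, P a → P b → P (a + b))
    (smul : ∀ (c : ℂ) a, P a → P (c • a)) (mul : ∀ a b, P a → P b → P (a * b))
    (closed : IsClosed {a | P a}) (a : generated s) : P a := by
  refine closure_minimal (fun b hb => ?_) closed a.2
  refine (?_ : P b ∧ P (star b)).1
  induction hb using NonUnitalStarAlgebra.adjoin_induction with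
  | mem b hb => exact ⟨mem b hb, mem _ (hs b hb)⟩
  | add b c _ _ hb hc => exact ⟨add _ _ hb.1 hc.1, by rw [star_add]; exact add _ _ hb.2 hc.2⟩
  | zero => exact ⟨zero, by rwa [star_zero]⟩
  | mul b c _ _ hb hc => exact ⟨mul _ _ hb.1 hc.1, by rw [star_mul]; exact mul _ _ hc.2 hb.2⟩
  | smul c b _ hb => exact ⟨smul _ _ hb.1, by rw [star_smul]; exact smul _ _ hb.2⟩
  | star b _ hb => exact ⟨hb.2, by rw [star_star]; exact hb.1⟩

end MultiplierExtension

/-! ### Compactly supported extensions and circle-valued multipliers -/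

/-- A compactly supported form of Tietze's extension theorem. -/
theorem Topology.IsClosedEmbedding.exists_compactlySupported_extension {Y Z : Type*}
    [TopologicalSpace Y] [TopologicalSpace Z] [T2Space Z] [LocallyCompactSpace Z]
    [SigmaCompactSpace Z] {e : Y → Z} (he : IsClosedEmbedding e) {φ : Y → ℂ} (hφ : Continuous φ)
    (hs : HasCompactSupport φ) : ∃ Φ : C_c(Z, ℂ), ∀ y, Φ (e y) = φ y := by
  obtain ⟨g, hg⟩ := ContinuousMap.exists_extension' he ⟨φ, hφ⟩
  obtain ⟨b, hb1, -, hbs, -⟩ := exists_continuous_one_zero_of_isCompact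
    (hs.isCompact.image he.continuous) isClosed_empty (Set.disjoint_empty _)
  refine ⟨⟨⟨fun z => (b z : ℂ) * g z, by fun_prop⟩, ?_⟩, fun y => ?_⟩
  · exact (hbs.comp_left (g := fun t : ℝ => (t : ℂ)) (by simp)).mul_right
  · change (b (e y) : ℂ) * g (e y) = φ y
    have hgy : g (e y) = φ y := congrFun hg y
    rw [hgy]
    by_cases hy : y ∈ tsupport φ
    · rw [hb1 ⟨y, hy, rfl⟩]; simp
    · rw [image_eq_zero_of_notMem_tsupport hy, mul_zero]

theorem MeasureTheory.Lp.memLp_circle_mul {α : Type*} [TopologicalSpace α] [MeasurableSpace α]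
    [OpensMeasurableSpace α] {μ : Measure α} (c : C(α, Circle)) (u : Lp ℂ 2 μ) :
    MemLp (fun a => (c a : ℂ) * u a) 2 μ := by
  refine (Lp.memLp u).congr_norm ?_ (Eventually.of_forall fun a => ?_)
  · exact (continuous_subtype_val.comp (map_continuous c)).aestronglyMeasurable.mul
      (Lp.aestronglyMeasurable u)
  · rw [norm_mul, Circle.norm_coe, one_mul]

/-- Multiplication by a continuous circle-valued function, as an isometry of `L²`. -/
noncomputable def MeasureTheory.Lp.circleMul {α : Type*} [TopologicalSpace α] [MeasurableSpace α]
    [OpensMeasurableSpace α] (μ : Measure α) (c : C(α, Circle)) : Lp ℂ 2 μ →ₗᵢ[ℂ] Lp ℂ 2 μ :=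
  have hm := Lp.memLp_circle_mul (μ := μ) c
  { toFun := fun u => (hm u).toLp _
    map_add' := fun u v => by
      refine Lp.ext ?_
      filter_upwards [MemLp.coeFn_toLp (hm (u + v)), MemLp.coeFn_toLp (hm u),
        MemLp.coeFn_toLp (hm v), Lp.coeFn_add u v,
        Lp.coeFn_add ((hm u).toLp _) ((hm v).toLp _)] with a h1 h2 h3 h4 h5
      rw [h1, h5, Pi.add_apply, h2, h3, h4, Pi.add_apply, mul_add]
    map_smul' := fun k u => by
      refine Lp.ext ?_
      filter_upwards [MemLp.coeFn_toLp (hm (k • u)), MemLp.coeFn_toLp (hm u),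
        Lp.coeFn_smul k u, Lp.coeFn_smul k ((hm u).toLp _)] with a h1 h2 h3 h4
      rw [h1, RingHom.id_apply, h4, Pi.smul_apply, h2, h3, Pi.smul_apply, smul_eq_mul, smul_eq_mul]
      ring
    norm_map' := fun u => by
      change ‖(hm u).toLp _‖ = ‖u‖
      rw [Lp.norm_toLp, Lp.norm_def]
      congr 1
      exact eLpNorm_congr_norm_ae (Eventually.of_forall fun a => by
        rw [norm_mul, Circle.norm_coe, one_mul]) }

theorem MeasureTheory.Lp.coeFn_circleMul {α : Type*} [TopologicalSpace α] [MeasurableSpace α]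
    [OpensMeasurableSpace α] (μ : Measure α) (c : C(α, Circle)) (u : Lp ℂ 2 μ) :
    Lp.circleMul μ c u =ᵐ[μ] fun a => (c a : ℂ) * u a :=
  MemLp.coeFn_toLp (Lp.memLp_circle_mul c u)

namespace TopologicalGroupoid

variable {Ξ X : Type u} [TopologicalSpace Ξ] [TopologicalSpace X] {G : TopologicalGroupoid Ξ X}

/-! ### Continuous sections of the field of Hilbert spaces -/

section Sections

set_option linter.unusedSectionVars false

variable [T2Space Ξ] [LocallyCompactSpace Ξ] [SigmaCompactSpace Ξ]
variable [MeasurableSpace Ξ] [BorelSpace Ξ] (lam : G.HaarSystem) (ω : G.TwoCocycle)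

/-- Integrals along the fibres of a compactly supported function depend continuously on the fibre
and on a further parameter. -/
theorem continuous_integral_fiber_param (K : C_c(Ξ × Ξ, ℂ)) :
    Continuous fun p : Ξ × X => ∫ η : G.Fiber p.2, K (p.1, η.1) ∂(lam.measure p.2) := by
  have hL : IsCompact (Prod.snd '' tsupport K) := K.hasCompactSupport.isCompact.image continuous_snd
  have hslice : ∀ ξ : Ξ, HasCompactSupport fun η => K (ξ, η) := fun ξ =>
    HasCompactSupport.intro hL fun η hη => by
      by_contra hne
      exact hη ⟨(ξ, η), subset_tsupport _ hne, rfl⟩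
  have hint : ∀ (x : X) (ξ : Ξ), Integrable (fun η : G.Fiber x => K (ξ, η.1)) (lam.measure x) := by
    intro x ξ
    refine Continuous.integrable_of_hasCompactSupport (by fun_prop) ?_
    exact (hslice ξ).comp_isClosedEmbedding (G.isClosed_fiber x).isClosedEmbedding_subtypeVal
  -- `h` is a cut-off equal to `1` on all slices of the support; its integrals bound the fibre mass
  obtain ⟨b, hb1, -, hbs, -⟩ := exists_continuous_one_zero_of_isCompact hL isClosed_empty
    (Set.disjoint_empty _)
  let h : C_c(Ξ, ℂ) := ⟨⟨fun z => (b z : ℂ), by fun_prop⟩,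
    hbs.comp_left (g := fun t : ℝ => (t : ℂ)) (by simp)⟩
  obtain ⟨M, hM⟩ := exists_integral_le lam h
  have hhint : ∀ x, Integrable (fun η : G.Fiber x => ‖h η.1‖) (lam.measure x) := fun x =>
    (Continuous.integrable_of_hasCompactSupport (f := fun η : G.Fiber x => h η.1) (by fun_prop)
      (h.hasCompactSupport.comp_isClosedEmbedding
        (G.isClosed_fiber x).isClosedEmbedding_subtypeVal)).norm
  rw [continuous_iff_continuousAt]
  rintro ⟨ξ₀, x₀⟩
  rw [ContinuousAt, Metric.tendsto_nhds]
  intro ε hε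
  have hMpos : 0 < |M| + 1 := by positivity
  obtain ⟨v, hv, hvK⟩ := hL.mem_uniformity_of_prod (f := fun ξ η => K (ξ, η)) (s := Set.univ)
    (q := ξ₀) (map_continuous K).continuousOn (Set.mem_univ _) (Metric.dist_mem_uniformity
      (show 0 < ε / 2 / (|M| + 1) by positivity))
  rw [nhdsWithin_univ] at hv
  -- for the fixed parameter `ξ₀`, continuity in the fibre is the axiom of the Haar system
  let k₀ : C_c(Ξ, ℂ) := ⟨⟨fun η => K (ξ₀, η), by fun_prop⟩, hslice ξ₀⟩
  have h2 := Metric.tendsto_nhds.1 ((lam.continuous_integral k₀).tendsto x₀) (ε / 2) (by positivity)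
  rw [nhds_prod_eq]
  filter_upwards [prod_mem_prod hv h2] with p hp
  obtain ⟨hp1, hp2⟩ := hp
  refine (dist_triangle _ (∫ η : G.Fiber p.2, K (ξ₀, η.1) ∂(lam.measure p.2)) _).trans_lt ?_
  have h3 : dist (∫ η : G.Fiber p.2, K (p.1, η.1) ∂(lam.measure p.2))
      (∫ η : G.Fiber p.2, K (ξ₀, η.1) ∂(lam.measure p.2)) ≤ ε / 2 := by
    rw [dist_eq_norm, ← integral_sub (hint _ _) (hint _ _)]
    calc _ ≤ ∫ η : G.Fiber p.2, ε / 2 / (|M| + 1) * ‖h η.1‖ ∂(lam.measure p.2) := by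
          refine norm_integral_le_of_norm_le ((hhint _).const_mul _) (Eventually.of_forall ?_)
          intro η
          by_cases hη : η.1 ∈ Prod.snd '' tsupport K
          · have e1 : h η.1 = 1 := by
              change ((b η.1 : ℝ) : ℂ) = 1
              rw [hb1 hη]; simp
            have e2 : dist (K (p.1, η.1)) (K (ξ₀, η.1)) < ε / 2 / (|M| + 1) := hvK _ hp1 _ hη
            rw [e1, norm_one, mul_one, ← dist_eq_norm]
            exact e2.le
          · have e1 : ∀ ξ, K (ξ, η.1) = 0 := fun ξ => by
              by_contra hne
              exact hη ⟨(ξ, η.1), subset_tsupport _ hne, rfl⟩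
            rw [e1, e1, sub_zero, norm_zero]
            positivity
      _ ≤ ε / 2 / (|M| + 1) * (|M| + 1) := by
          rw [integral_const_mul]
          gcongr
          exact (hM _).trans ((le_abs_self M).trans (by linarith))
      _ = ε / 2 := by field_simp
  have h4 : dist (∫ η : G.Fiber p.2, K (ξ₀, η.1) ∂(lam.measure p.2))
    (∫ η : G.Fiber x₀, K (ξ₀, η.1) ∂(lam.measure x₀)) < ε / 2 := hp2
  linarith

/-- The twisted convolution of two continuous compactly supported functions on `Ξ` is again
continuous and compactly supported: the integrand, a continuous compactly supported function on
the closed set of pairs with the same source, extends to `Ξ × Ξ`. -/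
theorem exists_convolution (f g : C_c(Ξ, ℂ)) :
    ∃ k : C_c(Ξ, ℂ), ∀ (x : X) (ξ : G.Fiber x), k ξ.1 = conv lam ω f (fun η => g η.1) ξ := by
  have := G.t2Space_units
  have hd := G.continuous_d
  have hi := G.continuous_inv
  let Y := {p : Ξ × Ξ // G.d p.1 = G.d p.2}
  have hY : IsClosedEmbedding (Subtype.val : Y → Ξ × Ξ) :=
    (isClosed_eq (by fun_prop) (by fun_prop)).isClosedEmbedding_subtypeVal
  let c : Y → G.Composable := fun p => G.divPair (x := G.d p.1.2) ⟨p.1.1, p.2⟩ ⟨p.1.2, rfl⟩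
  have hc : Continuous c := by
    refine Continuous.subtype_mk (Continuous.prodMk (G.continuous_mul.comp ?_) ?_) _
    · refine Continuous.subtype_mk ?_ _
      fun_prop
    · fun_prop
  let φ : Y → ℂ := fun p => f (c p).1.1 * g p.1.2 * (ω.toFun (c p) : ℂ)
  have hφ : Continuous φ := by
    have h1 := ω.continuous_toFun.comp hc
    have h2 : Continuous fun p : Y => (ω.toFun (c p) : ℂ) := continuous_subtype_val.comp h1
    fun_prop
  have hcs : IsCompact ((fun p : G.Composable => p.1) ⁻¹' (tsupport f ×ˢ tsupport g)) :=
    G.isClosed_composable.isClosedEmbedding_subtypeVal.isCompact_preimage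
      (f.hasCompactSupport.isCompact.prod g.hasCompactSupport.isCompact)
  have hφs : HasCompactSupport φ := by
    refine HasCompactSupport.intro
      (hY.isCompact_preimage ((hcs.image G.continuous_mul).prod g.hasCompactSupport.isCompact))
      fun p hp => ?_
    by_contra hne
    have hf : f (c p).1.1 ≠ 0 := fun h0 => hne (by simp [φ, h0])
    have hg : g p.1.2 ≠ 0 := fun h0 => hne (by simp [φ, h0])
    exact hp ⟨⟨c p, ⟨subset_tsupport _ hf, subset_tsupport _ hg⟩,
      G.mul_mul_inv_cancel p.1.1 p.1.2 p.2⟩, subset_tsupport _ hg⟩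
  obtain ⟨K, hK⟩ := hY.exists_compactlySupported_extension hφ hφs
  have hcont : Continuous fun ξ => ∫ η : G.Fiber (G.d ξ), K (ξ, η.1) ∂(lam.measure (G.d ξ)) :=
    (continuous_integral_fiber_param lam K).comp (continuous_id.prodMk G.continuous_d)
  refine ⟨⟨⟨_, hcont⟩, ?_⟩, ?_⟩
  · refine HasCompactSupport.intro (K.hasCompactSupport.isCompact.image continuous_fst)
      fun ξ hξ => ?_
    have : ∀ η, K (ξ, η) = 0 := fun η => by
      by_contra hne
      exact hξ ⟨(ξ, η), subset_tsupport _ hne, rfl⟩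
    simp [this]
  · rintro x ⟨ξ, rfl⟩
    refine integral_congr_ae (Eventually.of_forall fun η => ?_)
    refine (hK ⟨(ξ, η.1), η.2.symm⟩).trans ?_
    have e : c ⟨(ξ, η.1), η.2.symm⟩ = G.divPair ⟨ξ, rfl⟩ η := rfl
    change f (c ⟨(ξ, η.1), η.2.symm⟩).1.1 * g η.1 * (ω.toFun (c ⟨(ξ, η.1), η.2.symm⟩) : ℂ) = _
    rw [e]
    rfl

/-- The function `|g|²`, with complex values. -/
noncomputable def absSq (g : C_c(Ξ, ℂ)) : C_c(Ξ, ℂ) :=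
  ⟨⟨fun ξ => ((‖g ξ‖ ^ 2 : ℝ) : ℂ), by fun_prop⟩,
    g.hasCompactSupport.comp_left (g := fun z : ℂ => ((‖z‖ ^ 2 : ℝ) : ℂ)) (by simp)⟩

theorem memLp_restrict (g : C_c(Ξ, ℂ)) (x : X) :
    MemLp (fun η : G.Fiber x => g η.1) 2 (lam.measure x) :=
  Continuous.memLp_of_hasCompactSupport (by fun_prop) (g.hasCompactSupport.comp_isClosedEmbedding
    (G.isClosed_fiber x).isClosedEmbedding_subtypeVal)

/-- The restriction of a continuous compactly supported function to a fibre, as a vector of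
`L²(Ξ_x; λ_x)`. -/
noncomputable def restrict (g : C_c(Ξ, ℂ)) (x : X) : HilbertFiber lam x :=
  (memLp_restrict lam g x).toLp _

theorem coeFn_restrict (g : C_c(Ξ, ℂ)) (x : X) :
    restrict lam g x =ᵐ[lam.measure x] fun η => g η.1 := MemLp.coeFn_toLp _

theorem coeFn_regular (f : C_c(Ξ, ℂ)) (x : X) (u : HilbertFiber lam x) :
    regular lam ω x f u =ᵐ[lam.measure x] conv lam ω f u := MemLp.coeFn_toLp (memLp_conv lam ω f u)

theorem conv_congr_ae (f : C_c(Ξ, ℂ)) {x : X} {u v : G.Fiber x → ℂ} (h : u =ᵐ[lam.measure x] v) :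
    conv lam ω f u = conv lam ω f v := by
  ext ξ
  refine integral_congr_ae ?_
  filter_upwards [h] with η hη
  rw [hη]

theorem denseRange_restrict (x : X) : DenseRange fun g => restrict lam g x := by
  intro u
  have := G.locallyCompactSpace_fiber x
  have := G.sigmaCompactSpace_fiber x
  rw [Metric.mem_closure_iff]
  intro ε hε
  obtain ⟨φ, hφs, hφ, hφc, hφm⟩ := (Lp.memLp u).exists_hasCompactSupport_eLpNorm_sub_le
    ENNReal.ofNat_ne_top (ε := ENNReal.ofReal (ε / 2)) (by simpa using hε)
  obtain ⟨g, hg⟩ :=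
    (G.isClosed_fiber x).isClosedEmbedding_subtypeVal.exists_compactlySupported_extension hφc hφs
  refine ⟨_, ⟨g, rfl⟩, ?_⟩
  have e : restrict lam g x = hφm.toLp φ :=
    (MemLp.toLp_eq_toLp_iff _ _).2 (Eventually.of_forall hg)
  have e2 : u = (Lp.memLp u).toLp u := (Lp.toLp_coeFn u _).symm
  change dist u (restrict lam g x) < ε
  rw [e, dist_edist, e2, Lp.edist_toLp_toLp]
  refine (ENNReal.toReal_mono ENNReal.ofReal_ne_top hφ).trans_lt ?_
  rw [ENNReal.toReal_ofReal (by positivity)]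
  linarith

theorem norm_restrict_sq (g : C_c(Ξ, ℂ)) (x : X) :
    ((‖restrict lam g x‖ ^ 2 : ℝ) : ℂ)
      = ∫ η : G.Fiber x, ((‖g η.1‖ ^ 2 : ℝ) : ℂ) ∂(lam.measure x) := by
  push_cast
  refine (inner_self_eq_norm_sq_to_K (𝕜 := ℂ) (restrict lam g x)).symm.trans ?_
  rw [L2.inner_def]
  refine integral_congr_ae ?_
  filter_upwards [coeFn_restrict lam g x] with η hη
  rw [hη, inner_self_eq_norm_sq_to_K]
  rfl

/-- The restrictions of a function in `C_c(Ξ)` form a continuous section of the field of Hilbert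
spaces `L²(Ξ_x; λ_x)`; this is the continuity axiom of the Haar system, for `|g|²`. -/
theorem continuous_norm_restrict (g : C_c(Ξ, ℂ)) : Continuous fun x => ‖restrict lam g x‖ := by
  let h := absSq g
  have h1 : Continuous fun x => Real.sqrt (∫ η : G.Fiber x, h η.1 ∂(lam.measure x)).re :=
    (Complex.continuous_re.comp (lam.continuous_integral h)).sqrt
  refine h1.congr fun x => ?_
  rw [← Real.sqrt_sq (norm_nonneg (restrict lam g x))]
  congr 1
  rw [← Complex.ofReal_re (‖restrict lam g x‖ ^ 2), norm_restrict_sq]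
  rfl

theorem exists_regular_restrict (f g : C_c(Ξ, ℂ)) :
    ∃ k : C_c(Ξ, ℂ), ∀ x, regular lam ω x f (restrict lam g x) = restrict lam k x := by
  obtain ⟨k, hk⟩ := exists_convolution lam ω f g
  refine ⟨k, fun x => Lp.ext ?_⟩
  filter_upwards [coeFn_regular lam ω f x (restrict lam g x), coeFn_restrict lam k x] with ξ h1 h2
  rw [h1, h2, hk, conv_congr_ae lam ω f (coeFn_restrict lam g x)]

end Sections

/-! ### The involution and adjoints -/

section Adjoint

set_option linter.unusedSectionVars false

variable [T2Space Ξ] [LocallyCompactSpace Ξ] [SigmaCompactSpace Ξ]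
variable [MeasurableSpace Ξ] [BorelSpace Ξ] (lam : G.HaarSystem) (ω : G.TwoCocycle)

/-- The involution `f^⋆(ζ) = conj (f(ζ⁻¹) ω(ζ⁻¹, ζ))` of the twisted convolution algebra. -/
noncomputable def twistedStar (f : C_c(Ξ, ℂ)) : C_c(Ξ, ℂ) where
  toFun ζ := star (f (G.inv ζ) * (ω.toFun ⟨(G.inv ζ, ζ), G.d_inv ζ⟩ : ℂ))
  continuous_toFun := by
    have hi := G.continuous_inv
    have h1 : Continuous fun ζ => (⟨(G.inv ζ, ζ), G.d_inv ζ⟩ : G.Composable) :=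
      Continuous.subtype_mk (by fun_prop) _
    have h2 : Continuous fun ζ => (ω.toFun ⟨(G.inv ζ, ζ), G.d_inv ζ⟩ : ℂ) :=
      continuous_subtype_val.comp (ω.continuous_toFun.comp h1)
    fun_prop
  hasCompactSupport' := by
    refine HasCompactSupport.intro (f.hasCompactSupport.isCompact.image G.continuous_inv)
      fun ζ hζ => ?_
    have : f (G.inv ζ) = 0 := by
      by_contra hne
      exact hζ ⟨G.inv ζ, subset_tsupport _ hne, G.inv_inv ζ⟩
    simp [this]

/-- The cocycle identity for `(ζ⁻¹, ζ, ξ)` with `ζ = η ξ⁻¹`. -/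
theorem TwoCocycle.divPair_swap {x : X} (ξ η : G.Fiber x) :
    ω.toFun ⟨(G.inv (G.div η ξ), G.div η ξ), G.d_inv _⟩
      = ω.toFun (G.divPair η ξ) * ω.toFun (G.divPair ξ η) := by
  have h := ω.cocycle (G.inv (G.div η ξ)) (G.div η ξ) ξ.1 (G.d_inv _) (G.d_div η ξ)
  have h1 : G.mul ⟨(G.inv (G.div η ξ), G.div η ξ), G.d_inv _⟩ = G.unit (G.r ξ.1) := by
    rw [G.inv_mul, G.d_div]
  have h2 : ω.toFun ⟨(G.mul ⟨(G.inv (G.div η ξ), G.div η ξ), G.d_inv _⟩, ξ.1),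
      (G.d_mul _ _ (G.d_inv _)).trans (G.d_div η ξ)⟩ = 1 := by
    rw [← ω.unit_left ξ.1]
    exact congrArg ω.toFun (Subtype.ext (Prod.ext h1 rfl))
  rw [h2, mul_one] at h
  rw [h]
  congr 1
  refine congrArg ω.toFun (Subtype.ext (Prod.ext (G.inv_div η ξ) ?_))
  exact G.mul_mul_inv_cancel η.1 ξ.1 (η.2.trans ξ.2.symm)

theorem kernel_twistedStar (f : C_c(Ξ, ℂ)) {x : X} (ξ η : G.Fiber x) :
    kernel ω (twistedStar ω f) η ξ = star (kernel ω f ξ η) := by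
  have h1 : twistedStar ω f (G.div η ξ) = star (f (G.div ξ η)
      * ((ω.toFun (G.divPair η ξ) : ℂ) * (ω.toFun (G.divPair ξ η) : ℂ))) := by
    rw [← Circle.coe_mul, ← ω.divPair_swap, ← G.inv_div η ξ]
    rfl
  have h2 : star (ω.toFun (G.divPair η ξ) : ℂ) * (ω.toFun (G.divPair η ξ) : ℂ) = 1 := by
    rw [← starRingEnd_apply, ← Circle.coe_inv_eq_conj, ← Circle.coe_mul, inv_mul_cancel,
      Circle.coe_one]
  simp only [kernel, h1, star_mul']
  linear_combination (star (f (G.div ξ η)) * star (ω.toFun (G.divPair ξ η) : ℂ)) * h2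

/-- The inner product `⟪u, Π_x(f) v⟫` as a double integral over two functions in `C_c(Ξ)`. -/
theorem inner_restrict_regular (f g h : C_c(Ξ, ℂ)) (x : X) :
    inner ℂ (restrict lam g x) (regular lam ω x f (restrict lam h x)) =
      ∫ ξ : G.Fiber x, ∫ η : G.Fiber x, kernel ω f ξ η * h η.1 * star (g ξ.1)
        ∂(lam.measure x) ∂(lam.measure x) := by
  rw [L2.inner_def]
  refine integral_congr_ae ?_
  filter_upwards [coeFn_restrict lam g x, coeFn_regular lam ω f x (restrict lam h x)] with ξ h1 h2
  rw [h1, h2, conv_congr_ae lam ω f (coeFn_restrict lam h x), conv_eq, RCLike.inner_apply,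
    ← integral_mul_const]
  rfl

theorem star_regular (f : C_c(Ξ, ℂ)) (x : X) :
    star (regular lam ω x f) = regular lam ω x (twistedStar ω f) := by
  have := G.locallyCompactSpace_fiber x
  symm
  rw [ContinuousLinearMap.star_eq_adjoint, ContinuousLinearMap.eq_adjoint_iff]
  intro u v
  refine (denseRange_restrict lam x).induction_on (p := fun u => inner ℂ
    (regular lam ω x (twistedStar ω f) u) v = inner ℂ u (regular lam ω x f v)) u
    (isClosed_eq (by fun_prop) (by fun_prop)) fun g => ?_
  refine (denseRange_restrict lam x).induction_on (p := fun v => inner ℂ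
    (regular lam ω x (twistedStar ω f) (restrict lam g x)) v
      = inner ℂ (restrict lam g x) (regular lam ω x f v)) v
    (isClosed_eq (by fun_prop) (by fun_prop)) fun h => ?_
  rw [← inner_conj_symm, inner_restrict_regular, inner_restrict_regular, ← integral_conj]
  simp only [← integral_conj]
  have hcl := (G.isClosed_fiber x).isClosedEmbedding_subtypeVal
  have hg := g.hasCompactSupport.comp_isClosedEmbedding hcl
  have hh := h.hasCompactSupport.comp_isClosedEmbedding hcl
  rw [integral_integral_swap_of_hasCompactSupport]
  · refine integral_congr_ae (Eventually.of_forall fun ξ => integral_congr_ae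
      (Eventually.of_forall fun η => ?_))
    simp only [kernel_twistedStar, starRingEnd_apply, star_mul', star_star]
    ring
  · have hk := continuous_kernel ω (twistedStar ω f) x
    refine Complex.continuous_conj.comp ?_
    refine (hk.mul ?_).mul ?_ <;> fun_prop
  · refine HasCompactSupport.intro (hh.isCompact.prod hg.isCompact) ?_
    rintro ⟨ξ, η⟩ hp
    by_cases h1 : ξ ∈ tsupport ((h : Ξ → ℂ) ∘ Subtype.val)
    · have h2 : η ∉ tsupport ((g : Ξ → ℂ) ∘ Subtype.val) := fun h2 => hp ⟨h1, h2⟩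
      have : g η.1 = 0 :=
        image_eq_zero_of_notMem_tsupport (f := (g : Ξ → ℂ) ∘ Subtype.val) h2
      simp [Function.uncurry, this]
    · have : h ξ.1 = 0 :=
        image_eq_zero_of_notMem_tsupport (f := (h : Ξ → ℂ) ∘ Subtype.val) h1
      simp [Function.uncurry, this]

theorem star_regularFamily (f : C_c(Ξ, ℂ)) :
    star (regularFamily lam ω f) = regularFamily lam ω (twistedStar ω f) := by
  ext1
  funext x
  exact star_regular lam ω f x

set_option synthInstance.maxHeartbeats 200000 in
/-- An induction principle for elements of the reduced algebra, as bounded families of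
operators. -/
theorem reducedAlgebra_induction {P : lp (fun x => HilbertFiber lam x →L[ℂ] HilbertFiber lam x) ∞ →
      Prop} (mem : ∀ f, P (regularFamily lam ω f)) (zero : P 0)
    (add : ∀ a b, P a → P b → P (a + b)) (smul : ∀ (c : ℂ) a, P a → P (c • a))
    (mul : ∀ a b, P a → P b → P (a * b)) (closed : IsClosed {a | P a})
    (a : ReducedAlgebra lam ω) : P a := by
  refine MultiplierExtension.generated_induction ?_ ?_ zero add smul mul closed a
  · rintro _ ⟨f, rfl⟩
    exact ⟨twistedStar ω f, (star_regularFamily lam ω f).symm⟩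
  · rintro _ ⟨f, rfl⟩
    exact mem f

end Adjoint

/-! ### Translations between the fibres of an orbit -/

section Translation

set_option linter.unusedSectionVars false

variable [MeasurableSpace Ξ] [BorelSpace Ξ] (lam : G.HaarSystem) (ω : G.TwoCocycle)

theorem measurePreserving_rightMul (ξ : Ξ) :
    MeasurePreserving (G.rightMul ξ) (lam.measure (G.r ξ)) (lam.measure (G.d ξ)) :=
  ⟨(G.continuous_rightMul ξ).measurable, lam.map_rightMul ξ⟩

/-- The phase `ω(ζ, ξ)` on the fibre over `r ξ`. -/
def phase (ξ : Ξ) : C(G.Fiber (G.r ξ), Circle) where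
  toFun ζ := ω.toFun ⟨(ζ.1, ξ), ζ.2⟩
  continuous_toFun := ω.continuous_toFun.comp (Continuous.subtype_mk (by fun_prop) _)

/-- The isometry `(V w)(ζ) = ω(ζ, ξ)⁻¹ w(ζ ξ)` between the Hilbert spaces over `d ξ` and `r ξ`. -/
noncomputable def translation (ξ : Ξ) :
    HilbertFiber lam (G.d ξ) →ₗᵢ[ℂ] HilbertFiber lam (G.r ξ) :=
  (Lp.circleMul (lam.measure (G.r ξ)) (phase ω ξ)⁻¹).comp
    (Lp.compMeasurePreservingₗᵢ ℂ (G.rightMul ξ) (measurePreserving_rightMul lam ξ))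

theorem coeFn_translation (ξ : Ξ) (w : HilbertFiber lam (G.d ξ)) :
    translation lam ω ξ w =ᵐ[lam.measure (G.r ξ)]
      fun ζ => (((phase ω ξ ζ)⁻¹ : Circle) : ℂ) * w (G.rightMul ξ ζ) := by
  have h1 := Lp.coeFn_circleMul (lam.measure (G.r ξ)) (phase ω ξ)⁻¹
    (Lp.compMeasurePreservingₗᵢ ℂ (G.rightMul ξ) (measurePreserving_rightMul lam ξ) w)
  have h2 := Lp.coeFn_compMeasurePreserving w (measurePreserving_rightMul lam ξ)
  filter_upwards [h1, h2] with ζ h1 h2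
  refine h1.trans ?_
  exact congrArg _ h2

theorem div_rightMul_rightMul (ξ : Ξ) (ζ ζ' : G.Fiber (G.r ξ)) :
    G.div (G.rightMul ξ ζ) (G.rightMul ξ ζ') = G.div ζ ζ' := by
  have h1 : G.mul ⟨(G.div ζ ζ', (G.rightMul ξ ζ').1),
      (G.d_div _ _).trans (G.r_mul _ _ _).symm⟩ = (G.rightMul ξ ζ).1 := by
    refine (G.mul_assoc (G.div ζ ζ') ζ'.1 ξ (G.d_div _ _) ζ'.2).symm.trans ?_
    refine congrArg G.mul (Subtype.ext (Prod.ext ?_ rfl))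
    exact G.mul_mul_inv_cancel ζ.1 ζ'.1 (ζ.2.trans ζ'.2.symm)
  have h2 := G.mul_inv_mul_cancel (G.div ζ ζ') (G.rightMul ξ ζ').1
    ((G.d_div _ _).trans (G.r_mul _ _ _).symm)
  refine Eq.trans ?_ h2
  exact congrArg G.mul (Subtype.ext (Prod.ext h1.symm rfl))

/-- The cocycle identity for `(ζ ζ'⁻¹, ζ', ξ)`. -/
theorem TwoCocycle.divPair_rightMul (ξ : Ξ) (ζ ζ' : G.Fiber (G.r ξ)) :
    ω.toFun (G.divPair ζ ζ') * phase ω ξ ζ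
      = phase ω ξ ζ' * ω.toFun (G.divPair (G.rightMul ξ ζ) (G.rightMul ξ ζ')) := by
  have h := ω.cocycle (G.div ζ ζ') ζ'.1 ξ (G.d_div _ _) ζ'.2
  have h1 : ω.toFun ⟨(G.mul ⟨(G.div ζ ζ', ζ'.1), G.d_div _ _⟩, ξ),
      (G.d_mul _ _ (G.d_div _ _)).trans ζ'.2⟩ = phase ω ξ ζ := by
    refine congrArg ω.toFun (Subtype.ext (Prod.ext ?_ rfl))
    exact G.mul_mul_inv_cancel ζ.1 ζ'.1 (ζ.2.trans ζ'.2.symm)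
  rw [h1] at h
  refine h.trans (congrArg _ (congrArg ω.toFun (Subtype.ext (Prod.ext ?_ rfl))))
  exact (div_rightMul_rightMul ξ ζ ζ').symm

variable [T2Space Ξ] [LocallyCompactSpace Ξ] [SigmaCompactSpace Ξ]

/-- The translation intertwines the twisted convolutions by `f`, pointwise on the fibre. -/
theorem conv_rightMul (f : C_c(Ξ, ℂ)) (ξ : Ξ) {w : G.Fiber (G.d ξ) → ℂ}
    (hw : MemLp w 2 (lam.measure (G.d ξ))) (ζ : G.Fiber (G.r ξ)) :
    conv lam ω f (fun ζ' => (((phase ω ξ ζ')⁻¹ : Circle) : ℂ) * w (G.rightMul ξ ζ')) ζ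
      = (((phase ω ξ ζ)⁻¹ : Circle) : ℂ) * conv lam ω f w (G.rightMul ξ ζ) := by
  have hm := (integrable_kernel_mul lam ω f (G.rightMul ξ ζ) hw).aestronglyMeasurable
  rw [← lam.map_rightMul ξ] at hm
  have h := integral_map (G.continuous_rightMul ξ).aemeasurable hm
  rw [lam.map_rightMul ξ] at h
  rw [conv_eq, conv_eq, h, ← integral_const_mul]
  refine integral_congr_ae (Eventually.of_forall fun ζ' => ?_)
  have e : (ω.toFun (G.divPair ζ ζ') : ℂ) * (((phase ω ξ ζ')⁻¹ : Circle) : ℂ)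
      = (((phase ω ξ ζ)⁻¹ : Circle) : ℂ)
        * (ω.toFun (G.divPair (G.rightMul ξ ζ) (G.rightMul ξ ζ')) : ℂ) := by
    rw [← Circle.coe_mul, ← Circle.coe_mul]
    refine congrArg (fun z : Circle => (z : ℂ)) ?_
    rw [mul_comm (phase ω ξ ζ)⁻¹, ← div_eq_mul_inv, ← div_eq_mul_inv,
      div_eq_div_iff_mul_eq_mul, ω.divPair_rightMul, mul_comm]
  simp only [kernel, div_rightMul_rightMul]
  linear_combination (f (G.div ζ ζ') * w (G.rightMul ξ ζ')) * e

theorem translation_regular (f : C_c(Ξ, ℂ)) (ξ : Ξ) (w : HilbertFiber lam (G.d ξ)) :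
    translation lam ω ξ (regular lam ω (G.d ξ) f w)
      = regular lam ω (G.r ξ) f (translation lam ω ξ w) := by
  refine Lp.ext ?_
  filter_upwards [coeFn_translation lam ω ξ (regular lam ω (G.d ξ) f w),
    coeFn_regular lam ω f (G.r ξ) (translation lam ω ξ w),
    (measurePreserving_rightMul lam ξ).quasiMeasurePreserving.ae
      (coeFn_regular lam ω f (G.d ξ) w)] with ζ h1 h2 h3
  rw [h1, h2, h3, conv_congr_ae lam ω f (coeFn_translation lam ω ξ w),
    conv_rightMul lam ω f ξ (Lp.memLp w)]

theorem continuous_family_apply {x : X} :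
    Continuous fun a : lp (fun x => HilbertFiber lam x →L[ℂ] HilbertFiber lam x) ∞ => a x :=
  (continuous_apply x).comp lp.uniformContinuous_coe.continuous

theorem translation_regularRep (a : ReducedAlgebra lam ω) (ξ : Ξ) (w : HilbertFiber lam (G.d ξ)) :
    translation lam ω ξ (regularRep lam ω (G.d ξ) a w)
      = regularRep lam ω (G.r ξ) a (translation lam ω ξ w) := by
  revert w
  refine reducedAlgebra_induction lam ω (P := fun a => ∀ w, translation lam ω ξ (a (G.d ξ) w)
    = a (G.r ξ) (translation lam ω ξ w)) ?_ ?_ ?_ ?_ ?_ ?_ a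
  · exact fun f w => translation_regular lam ω f ξ w
  · exact fun w => map_zero _
  · intro a b ha hb w
    change translation lam ω ξ (a (G.d ξ) w + b (G.d ξ) w) = a (G.r ξ) _ + b (G.r ξ) _
    rw [map_add, ha, hb]
  · intro c a ha w
    change translation lam ω ξ (c • a (G.d ξ) w) = c • a (G.r ξ) _
    rw [map_smul, ha]
  · intro a b ha hb w
    change translation lam ω ξ (a (G.d ξ) (b (G.d ξ) w)) = a (G.r ξ) (b (G.r ξ) _)
    rw [ha, hb]
  · simp only [Set.ofPred_forall]
    refine isClosed_iInter fun w => isClosed_eq ?_ ?_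
    · exact (translation lam ω ξ).continuous.comp
        ((continuous_family_apply lam).clm_apply continuous_const)
    · exact (continuous_family_apply lam).clm_apply continuous_const

/-- The translation is isometric and intertwines `Π_{d ξ}` with `Π_{r ξ}`. Its surjectivity is not
needed for equality of the norms, as the reverse inequality comes from `ξ⁻¹`. -/
theorem norm_regularRep_d_le (a : ReducedAlgebra lam ω) (ξ : Ξ) :
    ‖regularRep lam ω (G.d ξ) a‖ ≤ ‖regularRep lam ω (G.r ξ) a‖ := by
  refine ContinuousLinearMap.opNorm_le_bound _ (norm_nonneg _) fun w => ?_
  rw [← (translation lam ω ξ).norm_map, translation_regularRep,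
    ← (translation lam ω ξ).norm_map w]
  exact ContinuousLinearMap.le_opNorm _ _

/-- The norm of `Π_x(a)` is constant along orbits. -/
theorem norm_regularRep_r_eq (a : ReducedAlgebra lam ω) (ξ : Ξ) :
    ‖regularRep lam ω (G.r ξ) a‖ = ‖regularRep lam ω (G.d ξ) a‖ := by
  refine le_antisymm ?_ (norm_regularRep_d_le lam ω a ξ)
  have h := norm_regularRep_d_le lam ω a (G.inv ξ)
  rwa [G.d_inv, G.r_inv] at h

end Translation

/-! ### Norms on orbit closures -/

section Semicontinuity

set_option linter.unusedSectionVars false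

variable [T2Space Ξ] [LocallyCompactSpace Ξ] [SigmaCompactSpace Ξ]
variable [MeasurableSpace Ξ] [BorelSpace Ξ] (lam : G.HaarSystem) (ω : G.TwoCocycle)

theorem restrict_add (g h : C_c(Ξ, ℂ)) (x : X) :
    restrict lam (g + h) x = restrict lam g x + restrict lam h x := by
  refine Lp.ext ?_
  filter_upwards [coeFn_restrict lam (g + h) x, coeFn_restrict lam g x, coeFn_restrict lam h x,
    Lp.coeFn_add (restrict lam g x) (restrict lam h x)] with η h1 h2 h3 h4
  rw [h1, h4, Pi.add_apply, h2, h3]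
  rfl

theorem restrict_smul (c : ℂ) (g : C_c(Ξ, ℂ)) (x : X) :
    restrict lam (c • g) x = c • restrict lam g x := by
  refine Lp.ext ?_
  filter_upwards [coeFn_restrict lam (c • g) x, coeFn_restrict lam g x,
    Lp.coeFn_smul c (restrict lam g x)] with η h1 h2 h4
  rw [h1, h4, Pi.smul_apply, h2]
  rfl

theorem exists_norm_restrict_le (g : C_c(Ξ, ℂ)) : ∃ M, ∀ x : X, ‖restrict lam g x‖ ≤ M := by
  let h := absSq g
  obtain ⟨M, hM⟩ := exists_integral_le lam h
  refine ⟨Real.sqrt M, fun x => Real.le_sqrt_of_sq_le ?_⟩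
  refine le_trans ?_ (hM x)
  have h1 := congrArg norm (norm_restrict_sq lam g x)
  rw [Complex.norm_real, Real.norm_of_nonneg (by positivity)] at h1
  rw [h1]
  exact norm_integral_le_integral_norm _

/-- The section `x ↦ Π_x(a) g_x` is a uniform limit of restrictions of functions in `C_c(Ξ)`. The
uniformity in `x` is what makes the property stable under products and limits in `a`. -/
theorem exists_approx_regularRep_restrict (a : ReducedAlgebra lam ω) (g : C_c(Ξ, ℂ)) {ε : ℝ}
    (hε : 0 < ε) :
    ∃ k : C_c(Ξ, ℂ), ∀ x, ‖regularRep lam ω x a (restrict lam g x) - restrict lam k x‖ ≤ ε := by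
  revert g ε
  refine reducedAlgebra_induction lam ω (P := fun a => ∀ (g : C_c(Ξ, ℂ)) {ε : ℝ}, 0 < ε →
    ∃ k : C_c(Ξ, ℂ), ∀ x, ‖a x (restrict lam g x) - restrict lam k x‖ ≤ ε) ?_ ?_ ?_ ?_ ?_ ?_ a
  · intro f g ε hε
    obtain ⟨k, hk⟩ := exists_regular_restrict lam ω f g
    refine ⟨k, fun x => ?_⟩
    change ‖regular lam ω x f (restrict lam g x) - restrict lam k x‖ ≤ ε
    rw [hk, sub_self, norm_zero]
    exact hε.le
  · intro g ε hε
    refine ⟨(0 : ℂ) • g, fun x => ?_⟩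
    rw [restrict_smul, zero_smul, sub_zero]
    change ‖(0 : HilbertFiber lam x)‖ ≤ ε
    rw [norm_zero]
    exact hε.le
  · intro a b ha hb g ε hε
    obtain ⟨k, hk⟩ := ha g (half_pos hε)
    obtain ⟨k', hk'⟩ := hb g (half_pos hε)
    refine ⟨k + k', fun x => ?_⟩
    change ‖a x (restrict lam g x) + b x (restrict lam g x) - restrict lam (k + k') x‖ ≤ ε
    rw [restrict_add, add_sub_add_comm]
    exact (norm_add_le _ _).trans ((add_le_add (hk x) (hk' x)).trans_eq (add_halves ε))
  · intro c a ha g ε hε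
    have hc : 0 < ‖c‖ + 1 := by positivity
    obtain ⟨k, hk⟩ := ha g (div_pos hε hc)
    refine ⟨c • k, fun x => ?_⟩
    change ‖c • a x (restrict lam g x) - restrict lam (c • k) x‖ ≤ ε
    rw [restrict_smul, ← smul_sub, norm_smul]
    calc ‖c‖ * _ ≤ (‖c‖ + 1) * (ε / (‖c‖ + 1)) := by
          gcongr
          · linarith
          · exact hk x
      _ = ε := by field_simp
  · intro a b ha hb g ε hε
    have hc : 0 < ‖a‖ + 1 := by positivity
    obtain ⟨k, hk⟩ := hb g (div_pos (half_pos hε) hc)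
    obtain ⟨k', hk'⟩ := ha k (half_pos hε)
    refine ⟨k', fun x => ?_⟩
    change ‖a x (b x (restrict lam g x)) - restrict lam k' x‖ ≤ ε
    have e : a x (b x (restrict lam g x)) - restrict lam k' x
        = a x (b x (restrict lam g x) - restrict lam k x)
          + (a x (restrict lam k x) - restrict lam k' x) := by
      rw [map_sub]; abel
    rw [e]
    have h1 : ‖a x (b x (restrict lam g x) - restrict lam k x)‖ ≤ ε / 2 := by
      calc _ ≤ ‖a x‖ * ‖b x (restrict lam g x) - restrict lam k x‖ :=
            ContinuousLinearMap.le_opNorm _ _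
        _ ≤ (‖a‖ + 1) * (ε / 2 / (‖a‖ + 1)) := by
            gcongr
            · exact (lp.norm_apply_le_norm ENNReal.top_ne_zero a x).trans (by linarith)
            · exact hk x
        _ = ε / 2 := by field_simp
    exact (norm_add_le _ _).trans ((add_le_add h1 (hk' x)).trans_eq (add_halves ε))
  · rw [← closure_subset_iff_isClosed]
    intro a ha g ε hε
    obtain ⟨M, hM⟩ := exists_norm_restrict_le lam g
    have hc : 0 < |M| + 1 := by positivity
    obtain ⟨b, hb, hab⟩ := Metric.mem_closure_iff.1 ha (ε / 2 / (|M| + 1)) (by positivity)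
    obtain ⟨k, hk⟩ := hb g (half_pos hε)
    refine ⟨k, fun x => ?_⟩
    have e : a x (restrict lam g x) - restrict lam k x
        = (a - b) x (restrict lam g x) + (b x (restrict lam g x) - restrict lam k x) := by
      change _ = a x (restrict lam g x) - b x (restrict lam g x) + _
      abel
    have h1 : ‖(a - b) x (restrict lam g x)‖ ≤ ε / 2 := by
      calc _ ≤ ‖(a - b) x‖ * ‖restrict lam g x‖ := ContinuousLinearMap.le_opNorm _ _
        _ ≤ ε / 2 / (|M| + 1) * (|M| + 1) := by
            gcongr
            · refine (lp.norm_apply_le_norm ENNReal.top_ne_zero (a - b) x).trans ?_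
              rw [← dist_eq_norm]
              exact hab.le
            · exact (hM x).trans ((le_abs_self M).trans (by linarith))
        _ = ε / 2 := by field_simp
    rw [e]
    exact (norm_add_le _ _).trans ((add_le_add h1 (hk x)).trans_eq (add_halves ε))

theorem continuous_norm_regularRep_restrict (a : ReducedAlgebra lam ω) (g : C_c(Ξ, ℂ)) :
    Continuous fun x => ‖regularRep lam ω x a (restrict lam g x)‖ := by
  refine continuous_of_uniform_approx_of_continuous fun u hu => ?_
  obtain ⟨ε, hε, hεu⟩ := Metric.mem_uniformity_dist.1 hu
  obtain ⟨k, hk⟩ := exists_approx_regularRep_restrict lam ω a g (half_pos hε)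
  refine ⟨_, continuous_norm_restrict lam k, fun x => hεu ?_⟩
  refine (dist_norm_norm_le _ _).trans_lt ((hk x).trans_lt (half_lt_self hε))

/-- The norm of `Π_y(a)` is at most that of `Π_x(a)` when `y` is in the orbit closure of `x`: the
inequality `‖Π_z(a) g_z‖ ≤ ‖Π_x(a)‖ ‖g_z‖`, for `g` in `C_c(Ξ)`, holds for `z` in the orbit of `x`
and is a closed condition on `z`. -/
theorem norm_regularRep_le_of_mem_orbitClosure (a : ReducedAlgebra lam ω) {x y : X}
    (hy : y ∈ G.orbitClosure x) : ‖regularRep lam ω y a‖ ≤ ‖regularRep lam ω x a‖ := by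
  refine ContinuousLinearMap.opNorm_le_bound _ (norm_nonneg _) fun u => ?_
  refine (denseRange_restrict lam y).induction_on
    (p := fun u => ‖regularRep lam ω y a u‖ ≤ ‖regularRep lam ω x a‖ * ‖u‖) u
    (isClosed_le (by fun_prop) (by fun_prop)) fun g => ?_
  refine closure_minimal ?_ (isClosed_le (continuous_norm_regularRep_restrict lam ω a g)
    (continuous_const.mul (continuous_norm_restrict lam g))) hy
  rintro _ ⟨ξ, rfl, rfl⟩
  change _ ≤ ‖regularRep lam ω (G.d ξ) a‖ * _
  rw [← norm_regularRep_r_eq]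
  exact ContinuousLinearMap.le_opNorm _ _

end Semicontinuity

/-! ### Nondegeneracy of the regular representations -/

section Nondegenerate

set_option linter.unusedSectionVars false

variable [T2Space Ξ] [LocallyCompactSpace Ξ] [SigmaCompactSpace Ξ]
variable [MeasurableSpace Ξ] [BorelSpace Ξ] (lam : G.HaarSystem) (ω : G.TwoCocycle)

/-- By the Cauchy-Schwarz inequality, `u ↦ f ⋆ u` is bounded from `L²` to the bounded functions. -/
theorem exists_norm_conv_sub_le (f : C_c(Ξ, ℂ)) (x : X) :
    ∃ M : ℝ, 0 < M ∧ ∀ (u v : HilbertFiber lam x) (ξ : G.Fiber x),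
      ‖conv lam ω f u ξ - conv lam ω f v ξ‖ ≤ M * ‖u - v‖ := by
  -- the Schur bound for `|f|²` bounds the `L²` norms of the kernels uniformly in `ξ`
  let h := absSq f
  obtain ⟨M, hM, hMb⟩ := exists_schur_bound lam h
  refine ⟨Real.sqrt M, Real.sqrt_pos.2 hM, fun u v ξ => ?_⟩
  have hm : MemLp (fun η => star (kernel ω f ξ η)) 2 (lam.measure x) :=
    (memLp_kernel lam ω f ξ 2).star
  set κ : HilbertFiber lam x := hm.toLp _ with hκ
  have hconv : ∀ u : HilbertFiber lam x, conv lam ω f u ξ = inner ℂ κ u := fun u => by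
    rw [conv_eq, L2.inner_def]
    refine integral_congr_ae ?_
    filter_upwards [MemLp.coeFn_toLp hm] with η hη
    rw [hη, RCLike.inner_apply, starRingEnd_apply, star_star, mul_comm]
  have hκ2 : ((‖κ‖ ^ 2 : ℝ) : ℂ) = ∫ η : G.Fiber x, h (G.div ξ η) ∂(lam.measure x) := by
    push_cast
    refine (inner_self_eq_norm_sq_to_K (𝕜 := ℂ) κ).symm.trans ?_
    rw [L2.inner_def]
    refine integral_congr_ae ?_
    filter_upwards [MemLp.coeFn_toLp hm] with η hη
    rw [hη, inner_self_eq_norm_sq_to_K, norm_star, norm_kernel]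
    change _ = ((‖f (G.div ξ η)‖ ^ 2 : ℝ) : ℂ)
    push_cast
    rfl
  have hκM : ‖κ‖ ≤ Real.sqrt M := by
    refine Real.le_sqrt_of_sq_le (le_trans ?_ ((hMb x).1 ξ))
    have h1 := congrArg norm hκ2
    rw [Complex.norm_real, Real.norm_of_nonneg (by positivity)] at h1
    rw [h1]
    exact norm_integral_le_integral_norm _
  rw [hconv, hconv, ← inner_sub_right]
  exact (norm_inner_le_norm _ _).trans (by gcongr)

/-- For `u` in `L²`, the function `f ⋆ u` is continuous, being a uniform limit of functions
`f ⋆ g` with `g` in `C_c(Ξ)`. -/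
theorem continuous_conv (f : C_c(Ξ, ℂ)) {x : X} (u : HilbertFiber lam x) :
    Continuous (conv lam ω f u) := by
  refine continuous_of_uniform_approx_of_continuous fun s hs => ?_
  obtain ⟨ε, hε, hεs⟩ := Metric.mem_uniformity_dist.1 hs
  obtain ⟨M, hM, hMb⟩ := exists_norm_conv_sub_le lam ω f x
  obtain ⟨_, ⟨g, rfl⟩, hg⟩ := Metric.mem_closure_iff.1 (denseRange_restrict lam x u) (ε / M)
    (by positivity)
  obtain ⟨k, hk⟩ := exists_convolution lam ω f g
  refine ⟨fun ξ => k ξ.1, by fun_prop, fun ξ => hεs ?_⟩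
  change dist _ (k ξ.1) < ε
  rw [hk, ← conv_congr_ae lam ω f (coeFn_restrict lam g x), dist_eq_norm]
  refine (hMb _ _ ξ).trans_lt ?_
  change dist u (restrict lam g x) < _ at hg
  rw [dist_eq_norm] at hg
  calc M * _ < M * (ε / M) := by gcongr
    _ = ε := by field_simp

theorem div_unit {x : X} (η : G.Fiber x) : G.div ⟨G.unit x, G.d_unit x⟩ η = G.inv η.1 := by
  refine Eq.trans ?_ (G.unit_mul (G.inv η.1))
  refine congrArg G.mul (Subtype.ext (Prod.ext ?_ rfl))
  change G.unit x = G.unit _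
  rw [G.r_inv, η.2]

theorem isClosedEmbedding_div_unit (x : X) :
    IsClosedEmbedding fun η : G.Fiber x => G.div ⟨G.unit x, G.d_unit x⟩ η := by
  let e : Ξ ≃ₜ Ξ := ⟨⟨G.inv, G.inv, G.inv_inv, G.inv_inv⟩, G.continuous_inv, G.continuous_inv⟩
  have h := e.isClosedEmbedding.comp (G.isClosed_fiber x).isClosedEmbedding_subtypeVal
  simp only [div_unit]
  exact h

/-- The regular representations are nondegenerate. If `f ⋆ u = 0` for all `f`, then this holds
pointwise, as `f ⋆ u` is continuous and `λ_x` has full support. At the unit `x` the kernels of the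
convolutions with the various `f` are all the continuous compactly supported functions. -/
theorem nondegenerate_regularRep (x : X) :
    MultiplierExtension.Nondegenerate (regularRep lam ω x) := by
  intro u hu
  have hzero : ∀ (f : C_c(Ξ, ℂ)) (ξ : G.Fiber x), conv lam ω f u ξ = 0 := fun f => by
    have h1 : regular lam ω x f u = 0 :=
      hu ⟨regularFamily lam ω f, NonUnitalStarSubalgebra.le_topologicalClosure _
        (NonUnitalStarAlgebra.subset_adjoin ℂ _ ⟨f, rfl⟩)⟩
    have h2 : conv lam ω f u =ᵐ[lam.measure x] fun _ => (0 : ℂ) := by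
      filter_upwards [coeFn_regular lam ω f x u, Lp.coeFn_zero ℂ 2 (lam.measure x)] with ξ h3 h4
      rw [← h3, h1, h4, Pi.zero_apply]
    exact congrFun (((continuous_conv lam ω f u).ae_eq_iff_eq _ continuous_const).1 h2)
  -- `f` is chosen so that `f(η⁻¹) ω(η⁻¹, η)` is the conjugate of `g(η)`
  have horth : ∀ g : C_c(Ξ, ℂ), inner ℂ (restrict lam g x) u = 0 := fun g => by
    let e : G.Fiber x := ⟨G.unit x, G.d_unit x⟩
    have hcw : Continuous fun η => (((ω.toFun (G.divPair e η))⁻¹ : Circle) : ℂ) :=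
      continuous_subtype_val.comp (ω.continuous_toFun.comp
        ((G.continuous_divPair x).comp (Continuous.prodMk_right e))).inv
    have hs : HasCompactSupport fun η : G.Fiber x => star (g η.1) :=
      (g.hasCompactSupport.comp_isClosedEmbedding
        (G.isClosed_fiber x).isClosedEmbedding_subtypeVal).comp_left (g := star) (star_zero ℂ)
    obtain ⟨f, hf⟩ := (isClosedEmbedding_div_unit x).exists_compactlySupported_extension
      (φ := fun η => star (g η.1) * (((ω.toFun (G.divPair e η))⁻¹ : Circle) : ℂ))
      (by fun_prop) hs.mul_right
    rw [← hzero f e, conv_eq, L2.inner_def]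
    refine integral_congr_ae ?_
    filter_upwards [coeFn_restrict lam g x] with η hη
    have hk : kernel ω f e η = star (g η.1) := by
      rw [kernel, hf, _root_.mul_assoc, ← Circle.coe_mul, inv_mul_cancel, Circle.coe_one, mul_one]
    rw [hη, hk, RCLike.inner_apply, mul_comm]
    rfl
  refine (inner_self_eq_zero (𝕜 := ℂ)).1 ?_
  exact (denseRange_restrict lam x).induction_on (p := fun v => inner ℂ v u = 0) u
    (isClosed_eq (by fun_prop) continuous_const) horth

end Nondegenerate

/-! ### Orbit closures and minimality -/

section Orbits

theorem mem_orbitClosure_self (x : X) : x ∈ G.orbitClosure x :=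
  subset_closure ⟨G.unit x, G.d_unit x, G.r_unit x⟩

theorem orbit_subset_of_mem {x y : X} (hy : y ∈ G.orbit x) : G.orbit y ⊆ G.orbit x := by
  obtain ⟨ξ, rfl, rfl⟩ := hy
  rintro _ ⟨η, hη, rfl⟩
  exact ⟨G.mul ⟨(η, ξ), hη⟩, G.d_mul _ _ _, G.r_mul _ _ _⟩

/-- A Haar system makes the source map open: `x ↦ ∫ f dλ_x` is continuous, vanishes outside the
image of the support of `f`, and is positive at `d ξ` for a nonnegative `f` with `f ξ = 1`. -/
theorem HaarSystem.isOpenMap_d [T2Space Ξ] [LocallyCompactSpace Ξ] [MeasurableSpace Ξ]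
    [BorelSpace Ξ] (lam : G.HaarSystem) : IsOpenMap G.d := by
  intro U hU
  rw [isOpen_iff_mem_nhds]
  rintro _ ⟨ξ, hξ, rfl⟩
  obtain ⟨b, hb1, hb0, hbs, hb⟩ := exists_continuous_one_zero_of_isCompact
    (isCompact_singleton (x := ξ)) hU.isClosed_compl (by simpa using hξ)
  let f : C_c(Ξ, ℂ) := ⟨⟨fun z => (b z : ℂ), by fun_prop⟩,
    hbs.comp_left (g := fun t : ℝ => (t : ℂ)) (by simp)⟩
  have hpos : (∫ η : G.Fiber (G.d ξ), f η.1 ∂(lam.measure (G.d ξ))) ≠ 0 := by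
    have h1 : 0 < ∫ η : G.Fiber (G.d ξ), b η.1 ∂(lam.measure (G.d ξ)) := by
      refine Continuous.integral_pos_of_hasCompactSupport_nonneg_nonzero (by fun_prop)
        (hbs.comp_isClosedEmbedding (G.isClosed_fiber _).isClosedEmbedding_subtypeVal)
        (fun η => (hb η.1).1) (x := ⟨ξ, rfl⟩) ?_
      rw [hb1 rfl]
      exact one_ne_zero
    have h2 : ∫ η : G.Fiber (G.d ξ), f η.1 ∂(lam.measure (G.d ξ))
      = ((∫ η : G.Fiber (G.d ξ), b η.1 ∂(lam.measure (G.d ξ)) : ℝ) : ℂ) := integral_ofReal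
    rw [h2]
    exact Complex.ofReal_ne_zero.2 h1.ne'
  filter_upwards [(lam.continuous_integral f).continuousAt.eventually_ne hpos] with x hx
  by_contra hxU
  refine hx (integral_eq_zero_of_ae (Eventually.of_forall fun η => ?_))
  have : η.1 ∈ Uᶜ := fun h => hxU ⟨η.1, h, η.2⟩
  change (b η.1 : ℂ) = 0
  rw [hb0 this]
  simp

theorem isInvariant_orbitClosure (hd : IsOpenMap G.d) (x : X) :
    G.IsInvariant (G.orbitClosure x) := by
  rintro _ hy _ ⟨ξ, rfl, rfl⟩
  refine mem_closure_iff.2 fun W hW hξW => ?_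
  obtain ⟨_, ⟨η, hηW, rfl⟩, hη⟩ := mem_closure_iff.1 hy _ (hd _ (hW.preimage G.continuous_r))
    ⟨ξ, hξW, rfl⟩
  exact ⟨G.r η, hηW, orbit_subset_of_mem hη ⟨η, rfl, rfl⟩⟩

/-- All points of a minimal orbit closure are generic. -/
theorem IsOrbitClosure.genericPoints_eq_of_isMinimal (hd : IsOpenMap G.d) {Q : Set X}
    (hQ : G.IsOrbitClosure Q) (hm : G.IsMinimal Q) : G.genericPoints Q = Q := by
  refine Set.Subset.antisymm (fun x hx => hx.1) fun x hx => ⟨hx, ?_⟩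
  obtain ⟨z, rfl⟩ := hQ
  have hsub : G.orbitClosure x ⊆ G.orbitClosure z :=
    closure_minimal (isInvariant_orbitClosure hd z x hx) isClosed_closure
  refine (hm _ hsub isClosed_closure (isInvariant_orbitClosure hd x)).resolve_left fun h => ?_
  exact Set.notMem_empty x (h ▸ mem_orbitClosure_self x)

end Orbits

end TopologicalGroupoid

theorem corollary3p6 {Ξ X : Type u} [TopologicalSpace Ξ] [TopologicalSpace X]
    [T2Space Ξ] [LocallyCompactSpace Ξ] [SigmaCompactSpace Ξ]
    [MeasurableSpace Ξ] [BorelSpace Ξ]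
    (G : TopologicalGroupoid Ξ X) (lam : G.HaarSystem) (ω : G.TwoCocycle)
    (S : CStarSpectralSet.{u})
    (F : 𝓜(ℂ, TopologicalGroupoid.ReducedAlgebra lam ω))
    (Q : Set X) (hQ : G.IsOrbitClosure Q) :
    (∀ x ∈ G.genericPoints Q, ∀ y ∈ G.genericPoints Q,
      S.toFun _ (TopologicalGroupoid.multiplierOperator lam ω F x) =
        S.toFun _ (TopologicalGroupoid.multiplierOperator lam ω F y)) ∧
    (G.IsMinimal Q → ∀ x ∈ Q, ∀ y ∈ Q,
      S.toFun _ (TopologicalGroupoid.multiplierOperator lam ω F x) =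
        S.toFun _ (TopologicalGroupoid.multiplierOperator lam ω F y)) := by
  have generic : ∀ x ∈ G.genericPoints Q, ∀ y ∈ G.genericPoints Q,
      S.toFun _ (TopologicalGroupoid.multiplierOperator lam ω F x) =
        S.toFun _ (TopologicalGroupoid.multiplierOperator lam ω F y) := by
    rintro x ⟨hx, hxQ⟩ y ⟨hy, hyQ⟩
    refine S.toFun_extension_eq (TopologicalGroupoid.nondegenerate_regularRep lam ω x)
      (TopologicalGroupoid.nondegenerate_regularRep lam ω y) (fun a => le_antisymm ?_ ?_) F
    · exact TopologicalGroupoid.norm_regularRep_le_of_mem_orbitClosure lam ω a (hyQ ▸ hx)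
    · exact TopologicalGroupoid.norm_regularRep_le_of_mem_orbitClosure lam ω a (hxQ ▸ hy)
  refine ⟨generic, fun hm => ?_⟩
  rwa [hQ.genericPoints_eq_of_isMinimal lam.isOpenMap_d hm] at generic
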